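/- Let $X$ be a complex Banach space and $A$ a closed, densely defined linear operator on $X$ with domain $D(A)$, resolvent set $\rho(A)$ and resolvent $R(\lambda,A)=(\lambda-A)^{-1}$. For $\theta,\omega\in\mathbb R$ put $A_\theta:=e^{-i\theta}A$ (with $D(A_\theta)=D(A)$) and $H_{\theta,\omega}:=\{e^{i\theta}\lambda:\operatorname{Re}\lambda>\omega\}$. Let $\rho_n(A)$ be the union of all half planes $H=H_{\theta,\omega}$ such that $H\subseteq\rho(A)$ and $\|R(\lambda,A)\|\le 1/d(\lambda,\partial H)$ for all $\lambda\in H$, and let $\sigma_n(A):=\mathbb C\setminus\rho_n(A)$ be the numerical spectrum of $A$. For $0<\delta<\pi/2$, $z\in\mathbb C$ and $\omega_1<\omega_2$ put $$\Sigma^\theta_\delta+z:=\{z+e^{-i\theta}\lambda:|\arg\lambda|\le\delta\}\quad(\text{vertex } z \text{ included}),\qquad \Pi^\theta_{\omega_1,\omega_2}:=\{e^{-i\theta}\lambda:\omega_1\le\operatorname{Re}\lambda\le\omega_2\}.$$ An operator generates an *$\omega$-contractive semigroup* if it generates a $C_0$-semigroup with $\|T(t)\|\le e^{\omega t}$ for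 $t\ge0$. It generates an *analytic $\omega$-contractive semigroup* if, for some $\delta\in(0,\pi/2]$, it generates an analytic semigroup of angle $\delta$ such that $\|T(z)\|\le e^{\omega\operatorname{Re}z}$ for all $z\neq0$ with $|\arg z|<\delta$. It generates a *norm continuous semigroup* if it generates a $C_0$-semigroup for which $t\mapsto T(t)$ is continuous on $[0,\infty)$ in the operator norm. It generates an *isometric group* if it generates a $C_0$-group $(U(t))_{t\in\mathbb R}$ with $\|U(t)x\|=\|x\|$ for all $t\in\mathbb R$, $x\in X$. **Classification.** At least one of the following holds: $\sigma_n(A)=\mathbb C$; $\sigma_n(A)$ is a closed half plane $\mathbb C\setminus H_{\theta,\omega}$; $\sigma_n(A)$ is contained in a sector $\Sigma^\theta_\delta+z$ with $0<\delta<\pi/2$; $\sigma_n(A)$ is contained in a strip $\Pi^\theta_{\omega_1,\omega_2}$ with $\omega_1<\omega_2$; $\sigma_n(A)$ is compact (with $\theta\in[0,2\pi)$ throughout). **Generator properties.** In (1)–(4), $\theta$ ranges over $[0,2\pi)$. 1. $\sigma_n(A)=\mathbb C$ if and only if there are no $\theta$ and $\omega\in\mathbb R$ such that $A_\theta$ generates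 an $\omega$-contractive semigroup. 2. $\sigma_n(A)\subseteq\mathbb C\setminus H_{\theta,\omega}$ for some $\theta,\omega$ if and only if there are $\theta,\omega$ such that $A_\theta$ generates an $\omega$-contractive semigroup. 3. $\sigma_n(A)\subseteq\Sigma^\theta_\delta+z$ for some $\theta$, some $0<\delta<\pi/2$ and some $z\in\mathbb C$ if and only if there are $\theta,\omega$ such that $A_\theta$ generates an analytic $\omega$-contractive semigroup. 4. $\sigma_n(A)\subseteq\Pi^\theta_{\omega_1,\omega_2}$ for some $\theta$ and $\omega_1<\omega_2$ if and only if there are $\theta$ and $\omega_1<\omega_2$ such that $A_\theta$ generates an $\omega_2$-contractive semigroup and $-A_\theta$ generates a $(-\omega_1)$-contractive semigroup. 5. $\sigma_n(A)$ is compact if and only if $A$ generates a norm continuous semigroup; equivalently, $\sigma_n(A)$ is contained in a compact set. The parameters correspond as follows. For all $\theta,\omega\in\mathbb R$, $\sigma_n(A)\subseteq\mathbb C\setminus H_{\theta,\omega}$ if and only if $A_\theta$ generates an $\omega$-contractive semigroup. For every $\theta\in\mathbb R$, $\sigma_n(A)\subseteq\Sigma^\theta_\delta+z$ for some $0<\delta<\pi/2$,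 $z\in\mathbb C$ if and only if $A_{\pi-\theta}$ generates an analytic $\omega$-contractive semigroup for some $\omega\in\mathbb R$. For all $\theta\in\mathbb R$ and $\omega_1<\omega_2$, $\sigma_n(A)\subseteq\Pi^\theta_{\omega_1,\omega_2}$ if and only if $A_{-\theta}$ generates an $\omega_2$-contractive semigroup and $-A_{-\theta}$ generates a $(-\omega_1)$-contractive semigroup. **Isometric groups.** $A$ generates an isometric group if and only if $\sigma_n(A)\subseteq i\mathbb R$. More generally, for every $\theta\in\mathbb R$, $A_\theta$ generates an isometric group if and only if $\sigma_n(A)\subseteq e^{i\theta}\,i\mathbb R$. -/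

import Mathlib

open Filter Topology Set
open scoped NNReal

namespace NumericalSpectrum

/-- The open half plane `H_{θ,ω} = {e^{iθ} λ : Re λ > ω}`. -/
def halfPlane (θ ω : ℝ) : Set ℂ :=
  {w | ω < (Complex.exp (-(Complex.I * θ)) * w).re}

/-- The closed sector `Σ^θ_δ + z = {z + e^{-iθ} λ : |arg λ| ≤ δ}` with vertex `z`
(the vertex is included, since `Complex.arg 0 = 0`). -/
def sector (θ δ : ℝ) (z : ℂ) : Set ℂ :=
  {w | |(Complex.exp (Complex.I * θ) * (w - z)).arg| ≤ δ}

/-- The closed strip `Π^θ_{ω₁,ω₂} = {e^{-iθ} λ : ω₁ ≤ Re λ ≤ ω₂}`. -/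
def strip (θ ω₁ ω₂ : ℝ) : Set ℂ :=
  {w | ω₁ ≤ (Complex.exp (Complex.I * θ) * w).re ∧ (Complex.exp (Complex.I * θ) * w).re ≤ ω₂}

/-- The open sector `{λ ≠ 0 : |arg λ| < δ}` around the positive half line. -/
def openSector (δ : ℝ) : Set ℂ :=
  {z | z ≠ 0 ∧ |z.arg| < δ}

section Operators

variable {X : Type*} [NormedAddCommGroup X] [NormedSpace ℂ X]

/-- The rotated operator `A_θ = e^{-iθ} A`, with the same domain as `A`. -/
noncomputable def rot (θ : ℝ) (A : X →ₗ.[ℂ] X) : X →ₗ.[ℂ] X :=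
  Complex.exp (-(Complex.I * θ)) • A

/-- `R` is the resolvent `R(μ, A) = (μ - A)⁻¹`: a bounded, everywhere defined two-sided inverse of
`μ - A : D(A) → X`. Such an `R` is unique if it exists. -/
def IsResolvent (A : X →ₗ.[ℂ] X) (μ : ℂ) (R : X →L[ℂ] X) : Prop :=
  (∀ x : X, ∃ h : R x ∈ A.domain, μ • R x - A ⟨R x, h⟩ = x) ∧
  ∀ x : A.domain, R (μ • (x : X) - A x) = x

/-- The resolvent set `ρ(A)`. -/
def resolventSet (A : X →ₗ.[ℂ] X) : Set ℂ :=
  {μ | ∃ R : X →L[ℂ] X, IsResolvent A μ R}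

/-- The numerical resolvent set `ρ_n(A)`: the union of all open half planes `H ⊆ ρ(A)` with
`‖R(μ, A)‖ ≤ 1 / d(μ, ∂H)` for all `μ ∈ H`. -/
def numericalResolventSet (A : X →ₗ.[ℂ] X) : Set ℂ :=
  {w | ∃ θ ∈ Ico (0 : ℝ) (2 * Real.pi), ∃ ω : ℝ, w ∈ halfPlane θ ω ∧
    halfPlane θ ω ⊆ resolventSet A ∧
    ∀ μ ∈ halfPlane θ ω, ∀ R : X →L[ℂ] X, IsResolvent A μ R →
      ‖R‖ ≤ 1 / Metric.infDist μ (frontier (halfPlane θ ω))}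

/-- The numerical spectrum `σ_n(A) = ℂ \ ρ_n(A)`. -/
def numericalSpectrum (A : X →ₗ.[ℂ] X) : Set ℂ :=
  (numericalResolventSet A)ᶜ

/-- A `C₀`-semigroup of bounded operators on `X`. -/
structure IsC0Semigroup (T : ℝ≥0 → X →L[ℂ] X) : Prop where
  map_zero : T 0 = ContinuousLinearMap.id ℂ X
  map_add : ∀ s t, T (s + t) = (T s).comp (T t)
  continuous_orbit : ∀ x, Continuous fun t => T t x

/-- `A` is the generator of `T`: the domain of `A` is the set of all `x` for which
`lim_{t ↓ 0} (T(t)x - x) / t` exists, and `A x` is that limit. -/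
def IsGenerator (A : X →ₗ.[ℂ] X) (T : ℝ≥0 → X →L[ℂ] X) : Prop :=
  ∀ x y : X, (x, y) ∈ A.graph ↔
    Tendsto (fun t : ℝ≥0 => (((t : ℝ) : ℂ)⁻¹) • (T t x - x)) (𝓝[>] 0) (𝓝 y)

/-- `A` generates an `ω`-contractive `C₀`-semigroup, i.e. one with `‖T(t)‖ ≤ e^{ωt}`. -/
def GeneratesContractive (A : X →ₗ.[ℂ] X) (ω : ℝ) : Prop :=
  ∃ T : ℝ≥0 → X →L[ℂ] X, IsC0Semigroup T ∧ IsGenerator A T ∧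
    ∀ t : ℝ≥0, ‖T t‖ ≤ Real.exp (ω * t)

/-- An analytic semigroup of angle `δ`. Only the values of `T` on `openSector δ ∪ {0}` matter. -/
structure IsAnalyticSemigroup (δ : ℝ) (T : ℂ → X →L[ℂ] X) : Prop where
  map_zero : T 0 = ContinuousLinearMap.id ℂ X
  map_add : ∀ z ∈ openSector δ, ∀ w ∈ openSector δ, T (z + w) = (T z).comp (T w)
  differentiableOn : DifferentiableOn ℂ T (openSector δ)
  tendsto_zero : ∀ δ' : ℝ, 0 < δ' → δ' < δ → ∀ x,
    Tendsto (fun z => T z x) (𝓝[openSector δ'] 0) (𝓝 x)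

/-- `A` generates an analytic `ω`-contractive semigroup: an analytic semigroup of some angle
`δ ∈ (0, π/2]` such that `e^{-ωz} T(z)` is a contraction for all `z` in its sector. -/
def GeneratesAnalyticContractive (A : X →ₗ.[ℂ] X) (ω : ℝ) : Prop :=
  ∃ δ : ℝ, 0 < δ ∧ δ ≤ Real.pi / 2 ∧ ∃ T : ℂ → X →L[ℂ] X, IsAnalyticSemigroup δ T ∧
    IsGenerator A (fun t : ℝ≥0 => T ((t : ℝ) : ℂ)) ∧
    ∀ z ∈ openSector δ, ‖T z‖ ≤ Real.exp (ω * z.re)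

/-- `A` generates a norm continuous semigroup: `t ↦ T(t)` is continuous on `[0, ∞)` for the
operator norm. -/
def GeneratesNormContinuous (A : X →ₗ.[ℂ] X) : Prop :=
  ∃ T : ℝ≥0 → X →L[ℂ] X, IsC0Semigroup T ∧ IsGenerator A T ∧ Continuous T

/-- `A` generates an isometric group: a strongly continuous group of isometries `(U(t))_{t ∈ ℝ}`
whose generator (given by the two-sided limit at `0`) is `A`. -/
def GeneratesIsometricGroup (A : X →ₗ.[ℂ] X) : Prop :=
  ∃ U : ℝ → X →L[ℂ] X, U 0 = ContinuousLinearMap.id ℂ X ∧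
    (∀ s t, U (s + t) = (U s).comp (U t)) ∧
    (∀ x, Continuous fun t => U t x) ∧
    (∀ x y : X, (x, y) ∈ A.graph ↔
      Tendsto (fun t : ℝ => ((t : ℂ)⁻¹) • (U t x - x)) (𝓝[≠] 0) (𝓝 y)) ∧
    ∀ t x, ‖U t x‖ = ‖x‖

end Operators

end NumericalSpectrum

/-!
An open half plane `H_{θ,ω}` satisfies the resolvent bound defining `ρ_n(A)` exactly when
`e^{-iθ} A - ω` is m-dissipative, and any half plane contained in `ρ_n(A)` is one of these: the
numerical range of `A` lies in `σ_n(A)`, and off a half plane containing the numerical range the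
resolvent is bounded by the reciprocal of the distance to it. By the Hille–Yosida theorem these
half planes correspond to the rotations `e^{-iθ} A` that generate contraction semigroups.

A sector or a strip is the intersection of two closed half planes, so the remaining classes amount
to two simultaneous contraction semigroups, which commute since their resolvents do. For a strip
with `ω₁ = ω₂ = 0` they are the two halves of an isometric group. For a sector they are generated
by `c A` and `conj c A`, up to a scalar shift, and `T(s c + t (conj c)) = S₁(s) S₂(t)` is the
analytic semigroup. If `σ_n(A)` is compact, then `λ R(λ, A)` is defined near `∞` and converges to
the identity in norm, so `R(λ, A)` is boundedly invertible for large `λ` and `A` is bounded.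
Conversely, a norm continuous semigroup has a bounded generator because its averages over short
intervals are invertible.
-/

namespace NumericalSpectrum

open Complex (I exp)
open MeasureTheory (IntegrableOn)
open scoped ComplexConjugate

section Resolvent

variable {X : Type*} [NormedAddCommGroup X] [NormedSpace ℂ X]
variable {A : X →ₗ.[ℂ] X} {μ ν : ℂ} {R S : X →L[ℂ] X} {x y : X}

theorem isResolvent_iff_graph :
    IsResolvent A μ R ↔ (∀ x, (R x, μ • R x - x) ∈ A.graph) ∧
      ∀ x y, (x, y) ∈ A.graph → R (μ • x - y) = x := by
  refine and_congr (forall_congr' fun x => ?_)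
    ⟨fun h x y hxy => ?_, fun h x => h _ _ (A.mem_graph x)⟩
  · simp only [LinearPMap.mem_graph_iff', sub_eq_iff_eq_add, eq_sub_iff_add_eq, Prod.mk.injEq]
    constructor
    · rintro ⟨h, hx⟩
      exact ⟨⟨R x, h⟩, rfl, by rw [hx, add_comm]⟩
    · rintro ⟨⟨z, hz⟩, rfl, hx⟩
      exact ⟨hz, by rw [← hx, add_comm]⟩
  · obtain ⟨x', rfl, rfl⟩ := (LinearPMap.mem_graph_iff A).1 hxy
    exact h x'

theorem IsResolvent.apply_mem_graph (h : IsResolvent A μ R) (x : X) :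
    (R x, μ • R x - x) ∈ A.graph :=
  (isResolvent_iff_graph.1 h).1 x

theorem IsResolvent.apply_smul_sub (h : IsResolvent A μ R) (hxy : (x, y) ∈ A.graph) :
    R (μ • x - y) = x :=
  (isResolvent_iff_graph.1 h).2 x y hxy

theorem IsResolvent.smul_apply_sub (h : IsResolvent A μ R) (hxy : (x, y) ∈ A.graph) :
    μ • R x - x = R y := by
  have := h.apply_smul_sub hxy
  rwa [map_sub, map_smul, sub_eq_iff_eq_add, ← sub_eq_iff_eq_add'] at this

theorem IsResolvent.unique (hR : IsResolvent A μ R) (hS : IsResolvent A μ S) : R = S := by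
  ext x
  simpa only [sub_sub_cancel] using hR.apply_smul_sub (hS.apply_mem_graph x)

theorem IsResolvent.sub_eq (hR : IsResolvent A μ R) (hS : IsResolvent A ν S) :
    R - S = (ν - μ) • (R * S) := by
  ext x
  have h := hR.apply_smul_sub (hS.apply_mem_graph x)
  rw [show μ • S x - (ν • S x - x) = x - (ν - μ) • S x by module, map_sub, map_smul] at h
  rw [sub_apply, sub_eq_iff_eq_add, ← sub_eq_iff_eq_add']
  exact h

theorem IsResolvent.commute (hR : IsResolvent A μ R) (hS : IsResolvent A ν S) :
    Commute R S := by
  rcases eq_or_ne μ ν with rfl | h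
  · rw [hR.unique hS]
  · refine smul_right_injective (X →L[ℂ] X) (sub_ne_zero.2 h.symm) ?_
    dsimp only
    rw [← hR.sub_eq hS, ← neg_sub S R, hS.sub_eq hR, ← neg_smul, neg_sub]

/-- The resolvent identity turns `R(μ)` into `R(ν) (1 + (μ - ν) R(ν))⁻¹`, and inversion is
differentiable at units. -/
theorem differentiableAt_of_isResolvent [CompleteSpace X] {U : Set ℂ} (hU : U ∈ 𝓝 ν)
    {R : ℂ → X →L[ℂ] X} (hR : ∀ μ ∈ U, IsResolvent A μ (R μ)) : DifferentiableAt ℂ R ν := by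
  have hν := hR ν (mem_of_mem_nhds hU)
  have hinv : ∀ μ ∈ U, R μ = R ν * Ring.inverse (1 + (μ - ν) • R ν) := fun μ hμ => by
    have hsub := hν.sub_eq (hR μ hμ)
    have hcomm := hν.commute (hR μ hμ)
    have hmul : (1 - (μ - ν) • R μ) * (1 + (μ - ν) • R ν) = 1 := by
      simp only [sub_mul, mul_add, one_mul, mul_one, smul_mul_assoc, mul_smul_comm,
        ← hcomm.eq, ← hsub]
      module
    have hmul' : (1 + (μ - ν) • R ν) * (1 - (μ - ν) • R μ) = 1 := by
      simp only [add_mul, mul_sub, one_mul, mul_one, smul_mul_assoc, mul_smul_comm, ← hsub]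
      module
    let u : (X →L[ℂ] X)ˣ := ⟨_, _, hmul', hmul⟩
    change R μ = R ν * Ring.inverse (u : X →L[ℂ] X)
    rw [Ring.inverse_unit]
    change R μ = R ν * (1 - (μ - ν) • R μ)
    rw [mul_sub, mul_one, mul_smul_comm, ← hsub, sub_sub_cancel]
  have hunit : DifferentiableAt ℂ Ring.inverse (1 + (ν - ν) • R ν) := by
    simpa using differentiableAt_inverse (𝕜 := ℂ) (isUnit_one (M := X →L[ℂ] X))
  refine DifferentiableAt.congr_of_eventuallyEq ?_ (eventually_of_mem hU hinv)
  exact (hunit.comp ν (by fun_prop : DifferentiableAt ℂ (fun μ => 1 + (μ - ν) • R ν) ν)).const_mul _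

end Resolvent

section Rescaling

variable {X : Type*} [NormedAddCommGroup X] [NormedSpace ℂ X]
variable {A : X →ₗ.[ℂ] X} {μ c w : ℂ} {R : X →L[ℂ] X} {x y : X} {θ : ℝ}

theorem mem_graph_smul_iff (hc : c ≠ 0) : (x, c • y) ∈ (c • A).graph ↔ (x, y) ∈ A.graph := by
  simp only [LinearPMap.mem_graph_iff, LinearPMap.smul_apply]
  exact exists_congr fun _ => and_congr_right fun _ => (smul_right_injective X hc).eq_iff

theorem isResolvent_smul_iff (hc : c ≠ 0) :
    IsResolvent (c • A) (c * μ) R ↔ IsResolvent A μ (c • R) := by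
  rw [isResolvent_iff_graph, isResolvent_iff_graph]
  refine and_congr (forall_congr' fun x => ?_) ⟨fun h x y hxy => ?_, fun h x y hxy => ?_⟩
  · rw [show (c * μ) • R x - x = c • (μ • R x - c⁻¹ • x) by
      rw [smul_sub, smul_smul, smul_inv_smul₀ hc], mem_graph_smul_iff hc, ← A.graph.smul_mem_iff hc,
      Prod.smul_mk, smul_sub, smul_inv_smul₀ hc, smul_comm c μ, smul_apply]
  · rw [smul_apply, ← map_smul, smul_sub, smul_smul]
    exact h _ _ ((mem_graph_smul_iff hc).2 hxy)
  · rw [← smul_inv_smul₀ hc y] at hxy ⊢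
    rw [mul_smul, ← smul_sub, map_smul]
    exact h _ _ ((mem_graph_smul_iff hc).1 hxy)

/-- The operator `A - w` with domain `D(A)`. -/
noncomputable def shift (w : ℂ) (A : X →ₗ.[ℂ] X) : X →ₗ.[ℂ] X :=
  ⟨A.domain, A.toFun - w • A.domain.subtype⟩

theorem mem_graph_shift_iff : (x, y) ∈ (shift w A).graph ↔ (x, y + w • x) ∈ A.graph := by
  simp only [LinearPMap.mem_graph_iff]
  refine exists_congr fun z => and_congr_right ?_
  rintro rfl
  exact sub_eq_iff_eq_add

theorem isResolvent_shift_iff : IsResolvent (shift w A) μ R ↔ IsResolvent A (μ + w) R := by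
  simp only [isResolvent_iff_graph, mem_graph_shift_iff]
  refine and_congr (forall_congr' fun x => ?_) ⟨fun h x y hxy => ?_, fun h x y hxy => ?_⟩
  · rw [show (μ + w) • R x - x = μ • R x - x + w • R x by module]
  · have := h x (y - w • x) (by simpa using hxy)
    rwa [show μ • x - (y - w • x) = (μ + w) • x - y by module] at this
  · have := h x (y + w • x) hxy
    rwa [show (μ + w) • x - (y + w • x) = μ • x - y by module] at this

theorem exp_mul_exp_neg (z : ℂ) : exp z * exp (-z) = 1 := by
  rw [← Complex.exp_add, add_neg_cancel, Complex.exp_zero]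

theorem norm_exp_neg_I_mul (θ : ℝ) : ‖exp (-(I * θ))‖ = 1 := by
  simp [Complex.norm_exp]

theorem isResolvent_rot_iff :
    IsResolvent (rot θ A) (exp (-(I * θ)) * μ) R ↔ IsResolvent A μ (exp (-(I * θ)) • R) :=
  isResolvent_smul_iff (Complex.exp_ne_zero _)

theorem rot_rot (θ φ : ℝ) (A : X →ₗ.[ℂ] X) : rot θ (rot φ A) = rot (θ + φ) A := by
  refine LinearPMap.ext rfl fun x hx hx' => ?_
  simp only [rot, LinearPMap.smul_apply, smul_smul, ← Complex.exp_add]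
  congr 2
  push_cast
  ring

theorem rot_zero (A : X →ₗ.[ℂ] X) : rot 0 A = A := by
  refine LinearPMap.ext rfl fun x hx hx' => ?_
  simp [rot]

theorem rot_pi_add (θ : ℝ) (A : X →ₗ.[ℂ] X) : rot (Real.pi + θ) A = -rot θ A := by
  rw [← rot_rot]
  refine LinearPMap.ext rfl fun x hx hx' => ?_
  change exp (-(I * Real.pi)) • rot θ A ⟨x, hx⟩ = -rot θ A ⟨x, hx⟩
  rw [mul_comm, Complex.exp_neg, Complex.exp_pi_mul_I, inv_neg_one, neg_one_smul]

theorem smul_shift (c w : ℂ) (A : X →ₗ.[ℂ] X) : c • shift w A = shift (c * w) (c • A) := by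
  refine LinearPMap.ext rfl fun x hx hx' => ?_
  change c • (A ⟨x, hx⟩ - w • x) = c • A ⟨x, hx⟩ - (c * w) • x
  rw [smul_sub, smul_smul]

end Rescaling

section StrongConvergence

variable {X : Type*} [NormedAddCommGroup X] [NormedSpace ℂ X] {ι : Type*} {l : Filter ι}

theorem tendsto_apply_of_dense {E : ι → X →L[ℂ] X} {E₀ : X →L[ℂ] X} {C : ℝ}
    (hC : ∀ᶠ i in l, ‖E i‖ ≤ C) {D : Set X} (hD : Dense D)
    (h : ∀ x ∈ D, Tendsto (fun i => E i x) l (𝓝 (E₀ x))) (x : X) :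
    Tendsto (fun i => E i x) l (𝓝 (E₀ x)) := by
  classical
  let F : ι → X →L[ℂ] X := fun i => if ‖E i‖ ≤ C then E i else 0
  have hF : ∀ᶠ i in l, F i = E i := hC.mono fun i hi => if_pos hi
  have hequi : Equicontinuous fun i x => F i x := by
    have htfae : Equicontinuous ((↑) ∘ F) ↔ ∃ C, ∀ i, ‖F i‖ ≤ C :=
      (NormedSpace.equicontinuous_TFAE F).out 1 5
    refine htfae.2 ⟨max C 0, fun i => ?_⟩
    by_cases hi : ‖E i‖ ≤ C
    · simpa only [F, if_pos hi] using hi.trans (le_max_left C 0)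
    · simp only [F, if_neg hi, norm_zero, le_max_right]
  have hclosed := hequi.isClosed_setOfPred_tendsto (l := l) E₀.continuous
  have hmem := hclosed.closure_subset_iff.2 (fun y hy =>
    (h y hy).congr' (hF.mono fun i hi => by simp only [hi])) (hD x)
  exact Tendsto.congr' (hF.mono fun i hi => by simp only [hi]) hmem

theorem tendsto_apply_of_norm_le {E : ι → X →L[ℂ] X} {C : ℝ} (hC : ∀ i, ‖E i‖ ≤ C) {u : ι → X}
    {x y : X} (hu : Tendsto u l (𝓝 x)) (h : Tendsto (fun i => E i x) l (𝓝 y)) :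
    Tendsto (fun i => E i (u i)) l (𝓝 y) := by
  have hsub : Tendsto (fun i => E i (u i - x)) l (𝓝 0) := by
    refine squeeze_zero_norm (fun i => (E i).le_of_opNorm_le (hC i) _) ?_
    simpa using (tendsto_iff_norm_sub_tendsto_zero.1 hu).const_mul C
  simpa using hsub.add h

theorem tendsto_smul_resolvent_apply {A : X →ₗ.[ℂ] X} (hA : Dense (A.domain : Set X))
    {a : ι → ℂ} {R : ι → X →L[ℂ] X} {C : ℝ} (ha : Tendsto a l (Bornology.cobounded ℂ))
    (hR : ∀ᶠ i in l, IsResolvent A (a i) (R i)) (hC : ∀ᶠ i in l, ‖a i • R i‖ ≤ C) (x : X) :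
    Tendsto (fun i => a i • R i x) l (𝓝 x) := by
  refine tendsto_apply_of_dense (E := fun i => a i • R i) (E₀ := 1) hC hA (fun x hx => ?_) x
  obtain ⟨y, hxy⟩ := LinearPMap.mem_domain_iff.1 hx
  have hzero : Tendsto (fun i => ‖a i‖⁻¹ * (C * ‖y‖)) l (𝓝 0) := by
    simpa using (tendsto_norm_cobounded_atTop.comp ha).inv_tendsto_atTop.mul_const (C * ‖y‖)
  refine tendsto_sub_nhds_zero_iff.1 (squeeze_zero_norm' ?_ hzero)
  filter_upwards [hR, hC, ha.eventually_ne_cobounded 0] with i hRi hCi hi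
  calc ‖a i • R i x - x‖ = ‖a i‖⁻¹ * ‖(a i • R i) y‖ := by
        rw [hRi.smul_apply_sub hxy, smul_apply, norm_smul,
          inv_mul_cancel_left₀ (norm_ne_zero_iff.2 hi)]
    _ ≤ ‖a i‖⁻¹ * (C * ‖y‖) := by
        gcongr
        exact ContinuousLinearMap.le_of_opNorm_le _ hCi y

end StrongConvergence

section MDissipative

variable {X : Type*} [NormedAddCommGroup X] [NormedSpace ℂ X]
variable {A : X →ₗ.[ℂ] X} {R : X →L[ℂ] X} {x y : X} {f : StrongDual ℂ X} {μ c z w : ℂ} {ω ω' : ℝ}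

/-- The (spatial) numerical range of `A`: the values `f (A x)` for unit vectors `x ∈ D(A)` and
functionals `f` of norm one with `f x = 1`. -/
def numericalRange (A : X →ₗ.[ℂ] X) : Set ℂ :=
  {w | ∃ x y, (x, y) ∈ A.graph ∧ ‖x‖ = 1 ∧ ∃ f : StrongDual ℂ X, ‖f‖ ≤ 1 ∧ f x = 1 ∧ f y = w}

/-- `A - ω` is m-dissipative: the numerical range lies in `{Re ≤ ω}` and the open half plane
`{Re > ω}` lies in the resolvent set. -/
structure IsMDissipative (A : X →ₗ.[ℂ] X) (ω : ℝ) : Prop where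
  re_le : ∀ w ∈ numericalRange A, w.re ≤ ω
  mem_resolventSet : ∀ μ : ℂ, ω < μ.re → μ ∈ resolventSet A

theorem dual_div_norm_mem_numericalRange (hxy : (x, y) ∈ A.graph) (hx : x ≠ 0) (hf : ‖f‖ ≤ 1)
    (hfx : f x = ‖x‖) : f y / ‖x‖ ∈ numericalRange A := by
  have hx' : (‖x‖ : ℂ) ≠ 0 := by exact_mod_cast norm_ne_zero_iff.2 hx
  refine ⟨_, _, A.graph.smul_mem (‖x‖ : ℂ)⁻¹ hxy, ?_, f, hf, ?_, ?_⟩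
  · exact norm_smul_inv_norm hx
  · rw [map_smul, hfx, smul_eq_mul, inv_mul_cancel₀ hx']
  · rw [map_smul, smul_eq_mul, inv_mul_eq_div]

theorem mul_mem_numericalRange_smul_iff (hc : c ≠ 0) :
    c * w ∈ numericalRange (c • A) ↔ w ∈ numericalRange A := by
  constructor
  · rintro ⟨x, y, hxy, hx, f, hf, hfx, hfy⟩
    rw [← smul_inv_smul₀ hc y] at hxy hfy
    refine ⟨x, c⁻¹ • y, (mem_graph_smul_iff hc).1 hxy, hx, f, hf, hfx, ?_⟩
    rwa [map_smul, smul_eq_mul, mul_right_inj' hc] at hfy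
  · rintro ⟨x, y, hxy, hx, f, hf, hfx, rfl⟩
    exact ⟨x, c • y, (mem_graph_smul_iff hc).2 hxy, hx, f, hf, hfx, by rw [map_smul, smul_eq_mul]⟩

theorem add_mem_numericalRange_of_shift (hw : w ∈ numericalRange (shift z A)) :
    w + z ∈ numericalRange A := by
  obtain ⟨x, y, hxy, hx, f, hf, hfx, rfl⟩ := hw
  refine ⟨x, _, mem_graph_shift_iff.1 hxy, hx, f, hf, hfx, ?_⟩
  rw [map_add, map_smul, hfx, smul_eq_mul, mul_one]

theorem le_norm_smul_sub_of_re_le (h : ∀ w ∈ numericalRange A, w.re ≤ ω) (hxy : (x, y) ∈ A.graph)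
    (μ : ℂ) : (μ.re - ω) * ‖x‖ ≤ ‖μ • x - y‖ := by
  rcases eq_or_ne x 0 with rfl | hx
  · simp
  obtain ⟨f, hf, hfx⟩ := exists_dual_vector'' ℂ x
  have hfy : (f y).re ≤ ω * ‖x‖ := by
    simpa [div_le_iff₀ (norm_pos_iff.2 hx)] using
      h _ (dual_div_norm_mem_numericalRange hxy hx hf hfx)
  calc (μ.re - ω) * ‖x‖ ≤ (f (μ • x - y)).re := by
        rw [map_sub, map_smul, hfx]
        simp only [RCLike.ofReal_eq_complex_ofReal, smul_eq_mul, Complex.sub_re,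
          Complex.mul_re, Complex.ofReal_re, Complex.ofReal_im]
        linarith
    _ ≤ ‖f (μ • x - y)‖ := Complex.re_le_norm _
    _ ≤ ‖μ • x - y‖ := by simpa using f.le_of_opNorm_le hf (μ • x - y)

theorem IsResolvent.norm_le_of_re_le (hR : IsResolvent A μ R)
    (h : ∀ w ∈ numericalRange A, w.re ≤ ω) (hμ : ω < μ.re) : ‖R‖ ≤ 1 / (μ.re - ω) := by
  have hpos : 0 < μ.re - ω := sub_pos.2 hμ
  refine R.opNorm_le_bound (by positivity) fun x => ?_
  have := le_norm_smul_sub_of_re_le h (hR.apply_mem_graph x) μ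
  rw [sub_sub_cancel] at this
  rwa [one_div, inv_mul_eq_div, le_div_iff₀' hpos]

theorem IsMDissipative.mono (h : IsMDissipative A ω) (hω : ω ≤ ω') : IsMDissipative A ω' :=
  ⟨fun w hw => (h.re_le w hw).trans hω, fun μ hμ => h.mem_resolventSet μ (hω.trans_lt hμ)⟩

theorem IsMDissipative.shift (h : IsMDissipative A ω) (z : ℂ) :
    IsMDissipative (shift z A) (ω - z.re) := by
  refine ⟨fun w hw => ?_, fun μ hμ => ?_⟩
  · have := h.re_le _ (add_mem_numericalRange_of_shift hw)
    rw [Complex.add_re] at this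
    linarith
  · obtain ⟨R, hR⟩ := h.mem_resolventSet (μ + z) (by rw [Complex.add_re]; linarith)
    exact ⟨R, isResolvent_shift_iff.2 hR⟩

/-- Put `u = a R(a, A) x - x = R(a, A) A x`. Contractivity of `a R(a, A)` gives `Re f(u) ≤ 0`,
while `a u → A x` as `a → ∞`. -/
theorem re_dual_nonpos_of_norm_resolvent_le (hA : Dense (A.domain : Set X))
    (hR : ∀ a : ℝ, 0 < a → ∃ R, IsResolvent A a R ∧ ‖R‖ ≤ 1 / a) (hxy : (x, y) ∈ A.graph)
    (hf : ‖f‖ ≤ 1) (hfx : f x = ‖x‖) : (f y).re ≤ 0 := by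
  choose! R hres hnorm using hR
  have hcontr : ∀ a : ℝ, 0 < a → ‖(a : ℂ) • R a‖ ≤ 1 := fun a ha => by
    rw [norm_smul, Complex.norm_of_nonneg ha.le, ← le_div_iff₀' ha]
    exact hnorm a ha
  have hneg : ∀ a : ℝ, 0 < a → (f ((a : ℂ) • R a y)).re ≤ 0 := fun a ha => by
    have hle : (f (((a : ℂ) • R a) x)).re ≤ ‖x‖ := by
      simpa using (Complex.re_le_norm _).trans
        (f.le_of_opNorm_le_of_le hf (ContinuousLinearMap.le_of_opNorm_le _ (hcontr a ha) x))
    rw [← (hres a ha).smul_apply_sub hxy, map_smul, smul_eq_mul, Complex.re_ofReal_mul,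
      map_sub, hfx]
    exact mul_nonpos_of_nonneg_of_nonpos ha.le (by simpa using hle)
  have hpos : ∀ᶠ a : ℝ in atTop, 0 < a := eventually_gt_atTop 0
  have hlim := tendsto_smul_resolvent_apply hA (RCLike.tendsto_ofReal_atTop_cobounded ℂ)
    (hpos.mono hres) (hpos.mono hcontr) y
  exact le_of_tendsto (((Complex.continuous_re.comp f.continuous).tendsto y).comp hlim)
    (hpos.mono hneg)

theorem isMDissipative_iff_norm_resolvent_le (hA : Dense (A.domain : Set X)) :
    IsMDissipative A ω ↔
      ∀ μ : ℂ, ω < μ.re → ∃ R, IsResolvent A μ R ∧ ‖R‖ ≤ 1 / (μ.re - ω) := by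
  refine ⟨fun h μ hμ => ?_, fun h => ⟨?_, fun μ hμ => (h μ hμ).imp fun R hR => hR.1⟩⟩
  · obtain ⟨R, hR⟩ := h.mem_resolventSet μ hμ
    exact ⟨R, hR, hR.norm_le_of_re_le h.re_le hμ⟩
  · rintro w ⟨x, y, hxy, hx, f, hf, hfx, rfl⟩
    have hshift : (x, y - (ω : ℂ) • x) ∈ (NumericalSpectrum.shift ω A).graph :=
      mem_graph_shift_iff.2 (by simpa using hxy)
    have hR : ∀ a : ℝ, 0 < a →
        ∃ R, IsResolvent (NumericalSpectrum.shift ω A) a R ∧ ‖R‖ ≤ 1 / a := fun a ha => by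
      obtain ⟨R, hR, hn⟩ := h (a + ω) (by simpa using ha)
      exact ⟨R, isResolvent_shift_iff.2 hR, by simpa using hn⟩
    have := re_dual_nonpos_of_norm_resolvent_le (A := NumericalSpectrum.shift ω A) hA hR hshift hf
      (by simp [hfx, hx])
    simpa [hfx] using this

end MDissipative

section HalfPlanes

theorem mem_halfPlane {θ ω : ℝ} {w : ℂ} : w ∈ halfPlane θ ω ↔ ω < (exp (-(I * θ)) * w).re :=
  Iff.rfl

theorem isOpen_halfPlane (θ ω : ℝ) : IsOpen (halfPlane θ ω) :=
  isOpen_lt continuous_const (by fun_prop)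

theorem frontier_halfPlane (θ ω : ℝ) :
    frontier (halfPlane θ ω) = {w | (exp (-(I * θ)) * w).re = ω} := by
  have h := (Homeomorph.mulLeft₀ _ (Complex.exp_ne_zero (-(I * θ)))).preimage_frontier
    {z | ω < z.re}
  rw [Complex.frontier_setOfPred_lt_re] at h
  exact h.symm

theorem infDist_frontier_halfPlane {θ ω : ℝ} {μ : ℂ} (hμ : μ ∈ halfPlane θ ω) :
    Metric.infDist μ (frontier (halfPlane θ ω)) = (exp (-(I * θ)) * μ).re - ω := by
  rw [frontier_halfPlane]
  set d := (exp (-(I * θ)) * μ).re - ω with hd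
  have hd₀ : 0 < d := sub_pos.2 hμ
  have hfoot : μ - d * exp (I * θ) ∈ {w : ℂ | (exp (-(I * θ)) * w).re = ω} := by
    rw [mem_ofPred_eq, mul_sub, mul_left_comm, mul_comm (exp (-(I * θ))) (exp (I * θ)),
      exp_mul_exp_neg, mul_one, Complex.sub_re, Complex.ofReal_re, hd, sub_sub_cancel]
  refine le_antisymm ?_ ((Metric.le_infDist ⟨_, hfoot⟩).2 fun w hw => ?_)
  · calc Metric.infDist μ _ ≤ dist μ (μ - d * exp (I * θ)) := Metric.infDist_le_dist_of_mem hfoot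
      _ = d := by simp [Complex.norm_exp, abs_of_pos hd₀]
  · calc d = (exp (-(I * θ)) * (μ - w)).re := by
          rw [mul_sub, Complex.sub_re, show (exp (-(I * θ)) * w).re = ω from hw]
      _ ≤ ‖exp (-(I * θ)) * (μ - w)‖ := Complex.re_le_norm _
      _ = dist μ w := by rw [norm_mul, norm_exp_neg_I_mul, one_mul, dist_eq_norm]

theorem exp_I_mul_toIcoMod (θ : ℝ) :
    exp (I * (toIcoMod Real.two_pi_pos 0 θ : ℝ)) = exp (I * θ) := by
  rw [← self_sub_toIcoDiv_zsmul Real.two_pi_pos 0 θ, Complex.exp_eq_exp_iff_exists_int]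
  refine ⟨-toIcoDiv Real.two_pi_pos 0 θ, ?_⟩
  push_cast [zsmul_eq_mul]
  ring

theorem exp_neg_I_mul_toIcoMod (θ : ℝ) :
    exp (-(I * (toIcoMod Real.two_pi_pos 0 θ : ℝ))) = exp (-(I * θ)) := by
  rw [Complex.exp_neg, exp_I_mul_toIcoMod, ← Complex.exp_neg]

theorem exists_mem_Ico_iff {P : ℝ → Prop}
    (hP : ∀ θ, P (toIcoMod Real.two_pi_pos 0 θ) ↔ P θ) :
    (∃ θ ∈ Ico (0 : ℝ) (2 * Real.pi), P θ) ↔ ∃ θ, P θ :=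
  ⟨fun ⟨θ, _, h⟩ => ⟨θ, h⟩, fun ⟨θ, h⟩ =>
    ⟨_, by simpa using toIcoMod_mem_Ico Real.two_pi_pos 0 θ, (hP θ).2 h⟩⟩

theorem halfPlane_toIcoMod (θ ω : ℝ) :
    halfPlane (toIcoMod Real.two_pi_pos 0 θ) ω = halfPlane θ ω := by
  rw [halfPlane, halfPlane, exp_neg_I_mul_toIcoMod]

theorem sector_toIcoMod (θ δ : ℝ) (z : ℂ) :
    sector (toIcoMod Real.two_pi_pos 0 θ) δ z = sector θ δ z := by
  rw [sector, sector, exp_I_mul_toIcoMod]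

theorem strip_toIcoMod (θ ω₁ ω₂ : ℝ) :
    strip (toIcoMod Real.two_pi_pos 0 θ) ω₁ ω₂ = strip θ ω₁ ω₂ := by
  rw [strip, strip, exp_I_mul_toIcoMod]

end HalfPlanes

section NumericalResolventSet

variable {X : Type*} [NormedAddCommGroup X] [NormedSpace ℂ X]
variable {A : X →ₗ.[ℂ] X} {θ ω : ℝ} {μ w : ℂ} {C : ℝ}

theorem rot_toIcoMod (θ : ℝ) (A : X →ₗ.[ℂ] X) :
    rot (toIcoMod Real.two_pi_pos 0 θ) A = rot θ A := by
  rw [rot, rot, exp_neg_I_mul_toIcoMod]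

theorem mem_resolventSet_rot_iff :
    exp (-(I * θ)) * μ ∈ resolventSet (rot θ A) ↔ μ ∈ resolventSet A :=
  (exists_congr fun _ => isResolvent_rot_iff).trans
    (MulAction.surjective₀ (Complex.exp_ne_zero (-(I * θ)))).exists.symm

theorem exists_isResolvent_rot_norm_le_iff :
    (∃ R, IsResolvent (rot θ A) (exp (-(I * θ)) * μ) R ∧ ‖R‖ ≤ C) ↔
      ∃ R, IsResolvent A μ R ∧ ‖R‖ ≤ C := by
  have hsurj : Function.Surjective fun R : X →L[ℂ] X => exp (-(I * θ)) • R :=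
    MulAction.surjective₀ (Complex.exp_ne_zero _)
  refine Iff.trans ?_ hsurj.exists.symm
  simp only [isResolvent_rot_iff, norm_smul, norm_exp_neg_I_mul, one_mul]

theorem isMDissipative_rot_iff (hA : Dense (A.domain : Set X)) :
    IsMDissipative (rot θ A) ω ↔ halfPlane θ ω ⊆ resolventSet A ∧
      ∀ μ ∈ halfPlane θ ω, ∀ R : X →L[ℂ] X, IsResolvent A μ R →
        ‖R‖ ≤ 1 / Metric.infDist μ (frontier (halfPlane θ ω)) := by
  have hrot := isMDissipative_iff_norm_resolvent_le (A := rot θ A) (ω := ω) hA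
  rw [(mul_left_surjective₀ (Complex.exp_ne_zero (-(I * θ)))).forall] at hrot
  simp only [exists_isResolvent_rot_norm_le_iff] at hrot
  refine hrot.trans ⟨fun h => ⟨fun μ hμ => (h μ hμ).imp fun R hR => hR.1, fun μ hμ S hS => ?_⟩,
    fun h μ hμ => ?_⟩
  · obtain ⟨R, hR, hn⟩ := h μ hμ
    rwa [hS.unique hR, infDist_frontier_halfPlane hμ]
  · obtain ⟨R, hR⟩ := h.1 hμ
    exact ⟨R, hR, infDist_frontier_halfPlane hμ ▸ h.2 μ hμ R hR⟩

theorem mem_numericalResolventSet_iff (hA : Dense (A.domain : Set X)) :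
    w ∈ numericalResolventSet A ↔ ∃ θ ω : ℝ, w ∈ halfPlane θ ω ∧ IsMDissipative (rot θ A) ω := by
  simp only [isMDissipative_rot_iff hA]
  exact exists_mem_Ico_iff fun θ => by simp only [halfPlane_toIcoMod]

theorem numericalRange_subset_numericalSpectrum (hA : Dense (A.domain : Set X)) :
    numericalRange A ⊆ numericalSpectrum A := by
  intro w hw hρ
  obtain ⟨θ, ω, hmem, hdiss⟩ := (mem_numericalResolventSet_iff hA).1 hρ
  exact (mem_halfPlane.1 hmem).not_ge
    (hdiss.re_le _ ((mul_mem_numericalRange_smul_iff (Complex.exp_ne_zero _)).2 hw))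

theorem numericalResolventSet_subset_resolventSet (A : X →ₗ.[ℂ] X) :
    numericalResolventSet A ⊆ resolventSet A :=
  fun _ ⟨_, _, _, hmem, hsub, _⟩ => hsub hmem

theorem numericalSpectrum_subset_compl_halfPlane_iff (hA : Dense (A.domain : Set X)) :
    numericalSpectrum A ⊆ (halfPlane θ ω)ᶜ ↔ IsMDissipative (rot θ A) ω := by
  have he := Complex.exp_ne_zero (-(I * θ))
  refine ⟨fun h => ⟨fun w hw => ?_, fun μ hμ => ?_⟩, fun h => ?_⟩
  · obtain ⟨w, rfl⟩ := mul_left_surjective₀ he w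
    exact not_lt.1 (h (numericalRange_subset_numericalSpectrum hA
      ((mul_mem_numericalRange_smul_iff he).1 hw)))
  · obtain ⟨μ, rfl⟩ := mul_left_surjective₀ he μ
    exact mem_resolventSet_rot_iff.2
      (numericalResolventSet_subset_resolventSet A (by_contra fun hσ => h hσ hμ))
  · rw [numericalSpectrum, compl_subset_compl]
    exact fun w hw => (mem_numericalResolventSet_iff hA).2 ⟨θ, ω, hw, h⟩

theorem isClosed_numericalSpectrum (hA : Dense (A.domain : Set X)) :
    IsClosed (numericalSpectrum A) := by
  refine isOpen_compl_iff.1 (isOpen_iff_mem_nhds.2 fun w hw => ?_)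
  rw [numericalSpectrum, compl_compl] at hw
  obtain ⟨θ, ω, hmem, h⟩ := (mem_numericalResolventSet_iff hA).1 hw
  filter_upwards [(isOpen_halfPlane θ ω).mem_nhds hmem] with v hv hσ
  exact (numericalSpectrum_subset_compl_halfPlane_iff hA).2 h hσ hv

end NumericalResolventSet

section Generators

variable {X : Type*} [NormedAddCommGroup X] [NormedSpace ℂ X]
variable {A : X →ₗ.[ℂ] X} {T : ℝ≥0 → X →L[ℂ] X} {ω t : ℝ} {w : ℂ} {x y : X} {R : X →L[ℂ] X}

theorem map_coe_nhdsGT_zero : map ((↑) : ℝ≥0 → ℝ) (𝓝[>] 0) = 𝓝[>] 0 := by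
  have h : 𝓝[>] (0 : ℝ≥0) = comap ((↑) : ℝ≥0 → ℝ) (𝓝[>] 0) := by
    rw [nhdsWithin, nhdsWithin, comap_inf, comap_principal, ← NNReal.coe_zero,
      ← NNReal.isEmbedding_coe.nhds_eq_comap]
    rfl
  rw [h, map_comap_of_mem]
  filter_upwards [self_mem_nhdsWithin] with t ht using ⟨⟨t, le_of_lt ht⟩, rfl⟩

theorem isGenerator_coe_iff_hasDerivWithinAt {U : ℝ → X →L[ℂ] X}
    (hU : U 0 = ContinuousLinearMap.id ℂ X) :
    IsGenerator A (fun t : ℝ≥0 => U t) ↔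
      ∀ x y, (x, y) ∈ A.graph ↔ HasDerivWithinAt (fun t => U t x) y (Ioi 0) 0 := by
  refine forall₂_congr fun x y => iff_congr Iff.rfl ?_
  rw [hasDerivWithinAt_iff_tendsto_slope' self_notMem_Ioi, ← map_coe_nhdsGT_zero,
    tendsto_map'_iff]
  refine tendsto_congr fun t => ?_
  simp [slope_def_module, hU, ← Complex.ofReal_inv]

theorem isGenerator_iff_hasDerivWithinAt (hT : T 0 = ContinuousLinearMap.id ℂ X) :
    IsGenerator A T ↔ ∀ x y, (x, y) ∈ A.graph ↔
      HasDerivWithinAt (fun t : ℝ => T t.toNNReal x) y (Ioi 0) 0 := by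
  simpa using isGenerator_coe_iff_hasDerivWithinAt (A := A) (U := fun t => T t.toNNReal)
    (by simpa using hT)

theorem IsC0Semigroup.apply_add (hT : IsC0Semigroup T) (s t : ℝ≥0) (x : X) :
    T (s + t) x = T s (T t x) := by
  rw [hT.map_add, ContinuousLinearMap.comp_apply]

theorem IsC0Semigroup.continuous_toNNReal (hT : IsC0Semigroup T) (x : X) :
    Continuous fun t : ℝ => T t.toNNReal x :=
  (hT.continuous_orbit x).comp continuous_real_toNNReal

theorem IsC0Semigroup.hasDerivWithinAt (hT : IsC0Semigroup T)
    (hzero : HasDerivWithinAt (fun t : ℝ => T t.toNNReal x) y (Ioi 0) 0) (ht : 0 ≤ t) :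
    HasDerivWithinAt (fun t : ℝ => T t.toNNReal x) (T t.toNNReal y) (Ioi t) t := by
  have hshift : HasDerivWithinAt (fun s : ℝ => T (s - t).toNNReal x) y (Ioi t) t := by
    have := HasDerivWithinAt.scomp (h := fun s : ℝ => s - t) (h' := 1) (s := Ioi t)
      (t' := Ioi 0) (g₁ := fun s : ℝ => T s.toNNReal x) (g₁' := y) t (by simpa using hzero)
      ((hasDerivAt_id t).sub_const t).hasDerivWithinAt
      (fun s hs => mem_Ioi.2 (sub_pos.2 (mem_Ioi.1 hs)))
    rwa [one_smul] at this
  have hcomp := ((T t.toNNReal).restrictScalars ℝ).hasFDerivAt.comp_hasDerivWithinAt t hshift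
  refine hcomp.congr (fun s (hs : t < s) => ?_) (by simp [hT.map_zero])
  change _ = T t.toNNReal (T (s - t).toNNReal x)
  rw [← hT.apply_add, ← Real.toNNReal_add ht (sub_nonneg.2 hs.le), add_sub_cancel]

theorem IsC0Semigroup.hasDerivAt [CompleteSpace X] (hT : IsC0Semigroup T)
    (hzero : HasDerivWithinAt (fun t : ℝ => T t.toNNReal x) y (Ioi 0) 0) (ht : 0 < t) :
    HasDerivAt (fun t : ℝ => T t.toNNReal x) (T t.toNNReal y) t := by
  have hintegral : ∀ s : ℝ, 0 ≤ s → T s.toNNReal x = x + ∫ r in (0 : ℝ)..s, T r.toNNReal y := by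
    intro s hs
    rw [intervalIntegral.integral_eq_sub_of_hasDeriv_right (hT.continuous_toNNReal x).continuousOn
      (fun r hr => hT.hasDerivWithinAt hzero (min_eq_left hs ▸ hr.1.le))
      ((hT.continuous_toNNReal y).intervalIntegrable _ _)]
    simp [hT.map_zero]
  refine (((hT.continuous_toNNReal y).integral_hasStrictDerivAt 0 t).hasDerivAt.const_add
    x).congr_of_eventuallyEq ?_
  filter_upwards [lt_mem_nhds ht] with s hs using hintegral s hs.le

theorem re_dual_le_of_hasDerivWithinAt (hT : T 0 = ContinuousLinearMap.id ℂ X)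
    (hω : ∀ t : ℝ≥0, ‖T t‖ ≤ Real.exp (ω * t))
    (h : HasDerivWithinAt (fun t : ℝ => T t.toNNReal x) y (Ioi 0) 0) {f : StrongDual ℂ X}
    (hf : ‖f‖ ≤ 1) (hfx : f x = ‖x‖) : (f y).re ≤ ω * ‖x‖ := by
  have hre := (Complex.reCLM.comp (f.restrictScalars ℝ)).hasFDerivAt.comp_hasDerivWithinAt 0 h
  have hexp : HasDerivWithinAt (fun t : ℝ => Real.exp (ω * t) * ‖x‖) (ω * ‖x‖) (Ioi 0) 0 := by
    simpa using
      (((hasDerivAt_id (0 : ℝ)).const_mul ω).exp.mul_const ‖x‖).hasDerivWithinAt (s := Ioi 0)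
  rw [hasDerivWithinAt_iff_tendsto_slope' self_notMem_Ioi] at hre hexp
  refine le_of_tendsto_of_tendsto hre hexp ?_
  filter_upwards [self_mem_nhdsWithin] with t (ht : 0 < t)
  have hle : (f (T t.toNNReal x)).re ≤ Real.exp (ω * t) * ‖x‖ := by
    have := f.le_of_opNorm_le_of_le hf ((T t.toNNReal).le_of_opNorm_le (hω _) x)
    rw [one_mul, Real.coe_toNNReal _ ht.le] at this
    exact (Complex.re_le_norm _).trans this
  have hzero : (f (T (0 : ℝ).toNNReal x)).re = ‖x‖ := by simp [hT, hfx]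
  simp only [slope_def_field, Function.comp_apply, ContinuousLinearMap.comp_apply,
    ContinuousLinearMap.coe_restrictScalars', Complex.reCLM_apply, hzero, mul_zero, Real.exp_zero,
    one_mul]
  gcongr

theorem IsGenerator.re_le_of_mem_numericalRange (hA : IsGenerator A T)
    (hT : T 0 = ContinuousLinearMap.id ℂ X) (hω : ∀ t : ℝ≥0, ‖T t‖ ≤ Real.exp (ω * t))
    (hw : w ∈ numericalRange A) : w.re ≤ ω := by
  obtain ⟨x, y, hxy, hx, f, hf, hfx, rfl⟩ := hw
  simpa [hx] using re_dual_le_of_hasDerivWithinAt hT hω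
    (((isGenerator_iff_hasDerivWithinAt hT).1 hA x y).1 hxy) hf (by simp [hfx, hx])

/-- If `T` has right derivative `y` at `0` along `x`, then so it has along
`x - R(μ) (μ x - y)`, with derivative `μ (x - R(μ) (μ x - y))`; as `Re μ` exceeds the growth
bound, this vector vanishes. -/
theorem isGenerator_of_forall_mem_graph {μ : ℂ} (hT : T 0 = ContinuousLinearMap.id ℂ X)
    (hω : ∀ t : ℝ≥0, ‖T t‖ ≤ Real.exp (ω * t))
    (h : ∀ x y, (x, y) ∈ A.graph → HasDerivWithinAt (fun t : ℝ => T t.toNNReal x) y (Ioi 0) 0)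
    (hμ : ω < μ.re) (hR : IsResolvent A μ R) : IsGenerator A T := by
  refine (isGenerator_iff_hasDerivWithinAt hT).2 fun x y => ⟨h x y, fun hxy => ?_⟩
  have hgraph := hR.apply_mem_graph (μ • x - y)
  set x' := R (μ • x - y)
  have hsub : HasDerivWithinAt (fun t : ℝ => T t.toNNReal (x - x')) (μ • (x - x')) (Ioi 0) 0 := by
    refine ((hxy.sub (h _ _ hgraph)).congr (fun s _ => ?_) ?_).congr_deriv (by module) <;>
      simp only [map_sub, Pi.sub_apply]
  obtain ⟨f, hf, hfx⟩ := exists_dual_vector'' ℂ (x - x')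
  have hle : μ.re * ‖x - x'‖ ≤ ω * ‖x - x'‖ := by
    simpa [hfx] using re_dual_le_of_hasDerivWithinAt hT hω hsub hf hfx
  have hzero : ‖x - x'‖ = 0 := by
    by_contra hne
    exact hμ.not_ge (le_of_mul_le_mul_right hle ((norm_nonneg _).lt_of_ne' hne))
  rw [← sub_eq_zero.1 (norm_eq_zero.1 hzero)] at hgraph
  simpa using hgraph

end Generators

section ExponentialScaling

variable {X : Type*} [NormedAddCommGroup X] [NormedSpace ℂ X]
variable {A : X →ₗ.[ℂ] X} {T : ℝ≥0 → X →L[ℂ] X} {w : ℂ} {y : X} {ω : ℝ}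

theorem shift_neg_shift (w : ℂ) (A : X →ₗ.[ℂ] X) : shift (-w) (shift w A) = A := by
  refine LinearPMap.ext rfl fun x hx hx' => ?_
  change A ⟨x, hx⟩ - w • x - (-w) • x = A ⟨x, hx⟩
  module

/-- The semigroup `e^{-wt} T(t)`, generated by `A - w` if `A` generates `T`. -/
noncomputable def expScale (w : ℂ) (T : ℝ≥0 → X →L[ℂ] X) (t : ℝ≥0) : X →L[ℂ] X :=
  exp (-(w * (t : ℝ))) • T t

theorem norm_expScale (t : ℝ≥0) : ‖expScale w T t‖ = Real.exp (-(w.re * t)) * ‖T t‖ := by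
  simp [expScale, norm_smul, Complex.norm_exp]

theorem norm_expScale_le (hω : ∀ t : ℝ≥0, ‖T t‖ ≤ Real.exp (ω * t)) (t : ℝ≥0) :
    ‖expScale w T t‖ ≤ Real.exp ((ω - w.re) * t) := by
  calc ‖expScale w T t‖ ≤ Real.exp (-(w.re * t)) * Real.exp (ω * t) := by
        rw [norm_expScale]
        gcongr
        exact hω t
    _ = Real.exp ((ω - w.re) * t) := by
        rw [← Real.exp_add]
        congr 1
        ring

theorem IsC0Semigroup.expScale (hT : IsC0Semigroup T) (w : ℂ) : IsC0Semigroup (expScale w T) where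
  map_zero := by simp [NumericalSpectrum.expScale, hT.map_zero]
  map_add s t := by
    simp only [NumericalSpectrum.expScale, hT.map_add, ContinuousLinearMap.smul_comp,
      ContinuousLinearMap.comp_smul, smul_smul, ← Complex.exp_add, NNReal.coe_add,
      Complex.ofReal_add, mul_add, neg_add, add_comm]
  continuous_orbit x := by
    have hexp : Continuous fun t : ℝ≥0 => exp (-(w * (t : ℝ))) := by fun_prop
    exact hexp.smul (hT.continuous_orbit x)

theorem hasDerivWithinAt_exp_smul_iff {u : ℝ → X} {s : Set ℝ} :
    HasDerivWithinAt (fun t : ℝ => exp (-(w * t)) • u t) y s 0 ↔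
      HasDerivWithinAt u (y + w • u 0) s 0 := by
  have hmul : ∀ (w : ℂ) {u : ℝ → X} {y : X}, HasDerivWithinAt u y s 0 →
      HasDerivWithinAt (fun t : ℝ => exp (-(w * t)) • u t) (y - w • u 0) s 0 := by
    intro w u y hu
    have hexp : HasDerivAt (fun t : ℝ => exp (-(w * t))) (-w) 0 := by
      simpa using ((hasDerivAt_id (0 : ℝ)).ofReal_comp.const_mul w).neg.cexp
    exact (hexp.hasDerivWithinAt.smul hu).congr_deriv (by simp [sub_eq_add_neg])
  refine ⟨fun h => ?_, fun h => by simpa using hmul w h⟩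
  have := hmul (-w) h
  simpa [smul_smul, ← Complex.exp_add] using this

theorem IsGenerator.expScale (hT : T 0 = ContinuousLinearMap.id ℂ X) (hA : IsGenerator A T)
    (w : ℂ) : IsGenerator (shift w A) (expScale w T) := by
  have hcoe : NumericalSpectrum.expScale w T =
      fun t : ℝ≥0 => exp (-(w * (t : ℝ))) • T (t : ℝ).toNNReal := by
    simp only [Real.toNNReal_coe, NumericalSpectrum.expScale, funext_iff, implies_true]
  rw [isGenerator_iff_hasDerivWithinAt hT] at hA
  rw [hcoe, isGenerator_coe_iff_hasDerivWithinAt (U := fun t => exp (-(w * t)) • T t.toNNReal)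
    (by simp [hT])]
  intro x y
  simp only [smul_apply, hasDerivWithinAt_exp_smul_iff, mem_graph_shift_iff, hA, Real.toNNReal_zero,
    hT, ContinuousLinearMap.id_apply]

end ExponentialScaling

section LaplaceTransform

variable {X : Type*} [NormedAddCommGroup X] [NormedSpace ℂ X]
variable {A : X →ₗ.[ℂ] X} {T : ℝ≥0 → X →L[ℂ] X} {ω ε : ℝ} {x y : X}

theorem norm_toNNReal_apply_le (h : ∀ t : ℝ≥0, ‖T t‖ ≤ Real.exp (-ε * t)) {t : ℝ} (ht : 0 ≤ t)
    (x : X) : ‖T t.toNNReal x‖ ≤ Real.exp (-ε * t) * ‖x‖ := by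
  simpa only [Real.coe_toNNReal _ ht] using (T t.toNNReal).le_of_opNorm_le (h _) x

theorem IsC0Semigroup.integrableOn_Ioi (hT : IsC0Semigroup T) (hε : 0 < ε)
    (h : ∀ t : ℝ≥0, ‖T t‖ ≤ Real.exp (-ε * t)) (x : X) :
    IntegrableOn (fun t : ℝ => T t.toNNReal x) (Ioi 0) :=
  MeasureTheory.Integrable.mono'
    ((integrableOn_exp_mul_Ioi (neg_lt_zero.2 hε) 0).mul_const ‖x‖)
    (hT.continuous_toNNReal x).aestronglyMeasurable.restrict
    (MeasureTheory.ae_restrict_of_forall_mem measurableSet_Ioi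
      fun _ ht => norm_toNNReal_apply_le h (le_of_lt ht) x)

theorem norm_integral_Ioi_le (hε : 0 < ε) (h : ∀ t : ℝ≥0, ‖T t‖ ≤ Real.exp (-ε * t)) (x : X) :
    ‖∫ t in Ioi (0 : ℝ), T t.toNNReal x‖ ≤ ε⁻¹ * ‖x‖ := by
  calc ‖∫ t in Ioi (0 : ℝ), T t.toNNReal x‖ ≤ ∫ t in Ioi (0 : ℝ), Real.exp (-ε * t) * ‖x‖ :=
        MeasureTheory.norm_integral_le_of_norm_le
          ((integrableOn_exp_mul_Ioi (neg_lt_zero.2 hε) 0).mul_const ‖x‖)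
          (MeasureTheory.ae_restrict_of_forall_mem measurableSet_Ioi
            fun _ ht => norm_toNNReal_apply_le h (le_of_lt ht) x)
    _ = ε⁻¹ * ‖x‖ := by
        rw [MeasureTheory.integral_mul_const, integral_exp_mul_Ioi (neg_lt_zero.2 hε)]
        simp

variable [CompleteSpace X]

theorem IsC0Semigroup.apply_integral_Ioi (hT : IsC0Semigroup T) (hε : 0 < ε)
    (h : ∀ t : ℝ≥0, ‖T t‖ ≤ Real.exp (-ε * t)) {s : ℝ} (hs : 0 ≤ s) (x : X) :
    T s.toNNReal (∫ t in Ioi (0 : ℝ), T t.toNNReal x) =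
      (∫ t in Ioi (0 : ℝ), T t.toNNReal x) - ∫ t in (0 : ℝ)..s, T t.toNNReal x := by
  have hint := hT.integrableOn_Ioi hε h x
  calc T s.toNNReal (∫ t in Ioi (0 : ℝ), T t.toNNReal x)
      = ∫ t in Ioi (0 : ℝ), T s.toNNReal (T t.toNNReal x) :=
        ((T s.toNNReal).integral_comp_comm hint).symm
    _ = ∫ t in (· + s) ⁻¹' Ioi s, T (t + s).toNNReal x := by
        rw [preimage_add_const_Ioi, sub_self]
        refine MeasureTheory.setIntegral_congr_fun measurableSet_Ioi fun t (ht : 0 < t) => ?_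
        rw [add_comm, Real.toNNReal_add hs ht.le, hT.apply_add]
    _ = ∫ t in Ioi s, T t.toNNReal x :=
        (MeasureTheory.measurePreserving_add_right _ s).setIntegral_preimage_emb
          (measurableEmbedding_addRight s) (fun t => T t.toNNReal x) _
    _ = _ := by rw [← intervalIntegral.integral_Ioi_sub_Ioi hint hs, sub_sub_cancel]

/-- The resolvent at `0` of the generator of an exponentially decaying semigroup is
`x ↦ ∫₀^∞ T(t) x dt`. -/
theorem IsGenerator.zero_mem_resolventSet (hA : IsGenerator A T) (hT : IsC0Semigroup T)
    (hε : 0 < ε) (h : ∀ t : ℝ≥0, ‖T t‖ ≤ Real.exp (-ε * t)) : 0 ∈ resolventSet A := by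
  have hint := hT.integrableOn_Ioi hε h
  let L : X →ₗ[ℂ] X :=
    { toFun := fun x => ∫ t in Ioi (0 : ℝ), T t.toNNReal x
      map_add' := fun x y => by
        simp only [map_add]
        exact MeasureTheory.integral_add (hint x) (hint y)
      map_smul' := fun c x => by
        simp only [map_smul, RingHom.id_apply]
        exact MeasureTheory.integral_smul c _ }
  refine ⟨L.mkContinuous ε⁻¹ (norm_integral_Ioi_le hε h),
    isResolvent_iff_graph.2 ⟨fun x => ?_, fun x y hxy => ?_⟩⟩
  · rw [zero_smul, zero_sub]
    refine ((isGenerator_iff_hasDerivWithinAt hT.map_zero).1 hA _ _).2 ?_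
    have hderiv : HasDerivWithinAt
        (fun s => L x - ∫ t in (0 : ℝ)..s, T t.toNNReal x) (-x) (Ioi 0) 0 := by
      simpa [hT.map_zero] using
        ((hT.continuous_toNNReal x).integral_hasStrictDerivAt 0 0).hasDerivAt.const_sub
          (L x) |>.hasDerivWithinAt (s := Ioi 0)
    exact hderiv.congr (fun s hs => hT.apply_integral_Ioi hε h (le_of_lt hs) x)
      (hT.apply_integral_Ioi hε h le_rfl x)
  · rw [zero_smul, zero_sub, map_neg]
    have hx := ((isGenerator_iff_hasDerivWithinAt hT.map_zero).1 hA x y).1 hxy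
    have hlim : Tendsto (fun t : ℝ => T t.toNNReal x) atTop (𝓝 0) := by
      have hexp : Tendsto (fun t : ℝ => Real.exp (-ε * t) * ‖x‖) atTop (𝓝 0) := by
        simpa using (Real.tendsto_exp_atBot.comp
          (tendsto_id.const_mul_atTop_of_neg (neg_lt_zero.2 hε))).mul_const ‖x‖
      refine squeeze_zero_norm' ?_ hexp
      filter_upwards [eventually_ge_atTop 0] with t ht using norm_toNNReal_apply_le h ht x
    have hftc := MeasureTheory.integral_Ioi_of_hasDerivAt_of_tendsto
      (hT.continuous_toNNReal x).continuousWithinAt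
      (fun t (ht : 0 < t) => hT.hasDerivAt hx ht) (hint y) hlim
    change -(∫ t in Ioi (0 : ℝ), T t.toNNReal y) = x
    rw [hftc]
    simp [hT.map_zero]

theorem GeneratesContractive.isMDissipative (h : GeneratesContractive A ω) :
    IsMDissipative A ω := by
  obtain ⟨T, hT, hA, hω⟩ := h
  refine ⟨fun w hw => hA.re_le_of_mem_numericalRange hT.map_zero hω hw, fun μ hμ => ?_⟩
  obtain ⟨R, hR⟩ := (hA.expScale hT.map_zero μ).zero_mem_resolventSet (hT.expScale μ)
    (sub_pos.2 hμ) fun t => by simpa using norm_expScale_le (w := μ) hω t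
  exact ⟨R, by simpa using isResolvent_shift_iff.1 hR⟩

end LaplaceTransform

section ContractiveExponential

variable {𝔸 : Type*} [NormedRing 𝔸] [NormedAlgebra ℝ 𝔸] [CompleteSpace 𝔸] {a b : 𝔸} {t : ℝ}

theorem norm_exp_le_exp_norm (h1 : ‖(1 : 𝔸)‖ ≤ 1) (a : 𝔸) :
    ‖NormedSpace.exp a‖ ≤ Real.exp ‖a‖ := by
  have hpow : ∀ n : ℕ, ‖a ^ n‖ ≤ ‖a‖ ^ n := by
    rintro (_ | n)
    · simpa using h1
    · exact norm_pow_le' a n.succ_pos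
  have hexp := NormedSpace.exp_series_hasSum_exp' (𝕂 := ℝ) ‖a‖
  rw [← Real.exp_eq_exp_ℝ] at hexp
  refine (NormedSpace.exp_series_hasSum_exp' (𝕂 := ℝ) a).norm_le_of_bounded hexp fun n => ?_
  rw [norm_smul, smul_eq_mul, Real.norm_of_nonneg (by positivity)]
  gcongr
  exact hpow n

theorem exp_add_of_commute (h : Commute a b) :
    NormedSpace.exp (a + b) = NormedSpace.exp a * NormedSpace.exp b := by
  let _ : NormedAlgebra ℚ 𝔸 := NormedAlgebra.restrictScalars ℚ ℝ 𝔸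
  exact NormedSpace.exp_add_of_commute h

theorem norm_exp_smul_sub_one_le (h1 : ‖(1 : 𝔸)‖ ≤ 1) (ha : ‖a‖ ≤ 1) (ht : 0 ≤ t) :
    ‖NormedSpace.exp (t • (a - 1))‖ ≤ 1 := by
  have hsplit : t • (a - 1) = t • a + algebraMap ℝ 𝔸 (-t) := by
    rw [Algebra.algebraMap_eq_smul_one]
    module
  rw [hsplit, exp_add_of_commute (Algebra.commute_algebraMap_right _ _),
    ← NormedSpace.algebraMap_exp_comm, ← Real.exp_eq_exp_ℝ, Algebra.algebraMap_eq_smul_one,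
    mul_smul_comm, mul_one, norm_smul, Real.norm_of_nonneg (Real.exp_pos _).le]
  calc Real.exp (-t) * ‖NormedSpace.exp (t • a)‖ ≤ Real.exp (-t) * Real.exp t := by
        gcongr
        refine (norm_exp_le_exp_norm h1 _).trans (Real.exp_le_exp.2 ?_)
        rw [norm_smul, Real.norm_of_nonneg ht]
        exact mul_le_of_le_one_right ht ha
    _ = 1 := by rw [← Real.exp_add, neg_add_cancel, Real.exp_zero]

variable {X : Type*} [NormedAddCommGroup X] [NormedSpace ℂ X] [CompleteSpace X]
variable {P Q : X →L[ℂ] X}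

theorem hasDerivAt_exp_smul_apply (P : X →L[ℂ] X) (x : X) (t : ℝ) :
    HasDerivAt (fun s : ℝ => NormedSpace.exp (s • P) x) (NormedSpace.exp (t • P) (P x)) t :=
  ((ContinuousLinearMap.apply ℂ X x).restrictScalars ℝ).hasFDerivAt.comp_hasDerivAt t
    (hasDerivAt_exp_smul_const (𝕂 := ℝ) P t)

/-- The curve `s ↦ e^{(t-s)Q} e^{sP} x` joins `e^{tQ} x` to `e^{tP} x`. -/
theorem norm_exp_sub_exp_apply_le (h : Commute P Q)
    (hP : ∀ t : ℝ, 0 ≤ t → ‖NormedSpace.exp (t • P)‖ ≤ 1)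
    (hQ : ∀ t : ℝ, 0 ≤ t → ‖NormedSpace.exp (t • Q)‖ ≤ 1) (x : X) (ht : 0 ≤ t) :
    ‖NormedSpace.exp (t • P) x - NormedSpace.exp (t • Q) x‖ ≤ t * ‖P x - Q x‖ := by
  have hcurve : ∀ (s : ℝ) (y : X),
      NormedSpace.exp (t • Q) (NormedSpace.exp (s • (P - Q)) y) =
        NormedSpace.exp ((t - s) • Q) (NormedSpace.exp (s • P) y) := fun s y => by
    have hmul : NormedSpace.exp (t • Q) * NormedSpace.exp (s • (P - Q)) =
        NormedSpace.exp ((t - s) • Q) * NormedSpace.exp (s • P) := by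
      rw [← exp_add_of_commute (((h.symm.sub_right (Commute.refl Q)).smul_left t).smul_right s),
        ← exp_add_of_commute ((h.symm.smul_left (t - s)).smul_right s)]
      congr 1
      module
    exact DFunLike.congr_fun hmul y
  have hderiv : ∀ s ∈ Icc 0 t, HasDerivWithinAt
      (fun s : ℝ => NormedSpace.exp (t • Q) (NormedSpace.exp (s • (P - Q)) x))
      (NormedSpace.exp (t • Q) (NormedSpace.exp (s • (P - Q)) ((P - Q) x))) (Icc 0 t) s :=
    fun s _ => (((NormedSpace.exp (t • Q)).restrictScalars ℝ).hasFDerivAt.comp_hasDerivAt s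
      (hasDerivAt_exp_smul_apply (P - Q) x s)).hasDerivWithinAt
  have hbound : ∀ s ∈ Ico 0 t,
      ‖NormedSpace.exp (t • Q) (NormedSpace.exp (s • (P - Q)) ((P - Q) x))‖ ≤ ‖P x - Q x‖ := by
    intro s hs
    rw [hcurve]
    simpa using (NormedSpace.exp ((t - s) • Q)).le_of_opNorm_le_of_le (hQ _ (sub_nonneg.2 hs.2.le))
      ((NormedSpace.exp (s • P)).le_of_opNorm_le (hP _ hs.1) ((P - Q) x))
  have hle := norm_image_sub_le_of_norm_deriv_le_segment' hderiv hbound t ⟨ht, le_rfl⟩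
  rw [hcurve, sub_self, zero_smul, NormedSpace.exp_zero, zero_smul, NormedSpace.exp_zero] at hle
  simpa [mul_comm] using hle

end ContractiveExponential

section Approximation

variable {X : Type*} [NormedAddCommGroup X] [NormedSpace ℂ X]
variable {B : X →ₗ.[ℂ] X} {Y : ℕ → X →L[ℂ] X} {T : ℝ≥0 → X →L[ℂ] X} {x y : X}

theorem isC0Semigroup_of_tendsto (hzero : T 0 = ContinuousLinearMap.id ℂ X)
    (hadd : ∀ s t, T (s + t) = (T s).comp (T t)) (hT : ∀ t, ‖T t‖ ≤ 1) {D : Set X} (hD : Dense D)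
    (h : ∀ x ∈ D, Tendsto (fun t => T t x) (𝓝 0) (𝓝 x)) : IsC0Semigroup T := by
  have hlim : ∀ x, Tendsto (fun t => T t x) (𝓝 0) (𝓝 x) :=
    tendsto_apply_of_dense (E₀ := 1) (Eventually.of_forall hT) hD h
  refine ⟨hzero, hadd, fun x => continuous_iff_continuousAt.2 fun t => ?_⟩
  have hle : ∀ s, dist (T s x) (T t x) ≤ dist (T (nndist s t) x) x := by
    have hcontr : ∀ s r, dist (T (s + r) x) (T s x) ≤ dist (T r x) x := fun s r => by
      rw [hadd, ContinuousLinearMap.comp_apply, dist_eq_norm, dist_eq_norm, ← map_sub]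
      exact (T s).le_of_opNorm_le (hT s) _ |>.trans_eq (one_mul _)
    have hnndist : ∀ s r : ℝ≥0, nndist (s + r) s = r := fun s r =>
      NNReal.coe_injective (by simp [NNReal.dist_eq])
    intro s
    rcases le_total s t with hst | hst <;> obtain ⟨r, rfl⟩ := exists_add_of_le hst
    · rw [dist_comm, nndist_comm, hnndist]
      exact hcontr s r
    · rw [hnndist]
      exact hcontr t r
  have hdist : Tendsto (fun s => nndist s t) (𝓝 t) (𝓝 0) := by
    simpa using (tendsto_id (x := 𝓝 t)).nndist (tendsto_const_nhds (x := t))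
  exact tendsto_iff_dist_tendsto_zero.2 (squeeze_zero (fun _ => dist_nonneg) hle
    (tendsto_iff_dist_tendsto_zero.1 ((hlim x).comp hdist)))

/-- Commuting bounded operators `Y n` generating contraction semigroups and converging strongly to
`B` on `D(B)`, like the Yosida approximations of a dissipative operator. -/
structure IsContractiveApproximation (B : X →ₗ.[ℂ] X) (Y : ℕ → X →L[ℂ] X) : Prop where
  commute : ∀ m n, Commute (Y m) (Y n)
  norm_exp_le : ∀ n (t : ℝ), 0 ≤ t → ‖NormedSpace.exp (t • Y n)‖ ≤ 1
  tendsto_apply : ∀ x y, (x, y) ∈ B.graph → Tendsto (fun n => Y n x) atTop (𝓝 y)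

theorem map_zero_of_tendsto_exp
    (hT : ∀ (t : ℝ≥0) x, Tendsto (fun n => NormedSpace.exp ((t : ℝ) • Y n) x) atTop (𝓝 (T t x))) :
    T 0 = ContinuousLinearMap.id ℂ X := by
  ext x
  exact tendsto_nhds_unique (hT 0 x) (tendsto_const_nhds.congr fun n => by simp)

namespace IsContractiveApproximation

theorem norm_le_one (h : IsContractiveApproximation B Y)
    (hT : ∀ (t : ℝ≥0) x, Tendsto (fun n => NormedSpace.exp ((t : ℝ) • Y n) x) atTop (𝓝 (T t x)))
    (t : ℝ≥0) : ‖T t‖ ≤ 1 :=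
  (T t).opNorm_le_bound zero_le_one fun x => le_of_tendsto' (hT t x).norm fun n =>
    (NormedSpace.exp ((t : ℝ) • Y n)).le_of_opNorm_le (h.norm_exp_le n t t.2) x

variable [CompleteSpace X]

theorem exists_tendsto_exp (h : IsContractiveApproximation B Y)
    (hB : Dense (B.domain : Set X)) : ∃ T : ℝ≥0 → X →L[ℂ] X,
      ∀ (t : ℝ≥0) x, Tendsto (fun n => NormedSpace.exp ((t : ℝ) • Y n) x) atTop (𝓝 (T t x)) := by
  have hcauchy : ∀ (t : ℝ≥0) x, CauchySeq fun n => NormedSpace.exp ((t : ℝ) • Y n) x := by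
    intro t x
    rw [cauchySeq_iff_tendsto_dist_atTop_0]
    simp only [dist_eq_norm]
    rw [← tendsto_zero_iff_norm_tendsto_zero]
    refine tendsto_apply_of_dense (C := 1 + 1) (E₀ := 0)
      (E := fun n : ℕ × ℕ => NormedSpace.exp ((t : ℝ) • Y n.1) - NormedSpace.exp ((t : ℝ) • Y n.2))
      (Eventually.of_forall fun n => (norm_sub_le _ _).trans
        (add_le_add (h.norm_exp_le _ _ t.2) (h.norm_exp_le _ _ t.2))) hB (fun x hx => ?_) x
    obtain ⟨y, hxy⟩ := LinearPMap.mem_domain_iff.1 hx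
    have hY := (cauchySeq_iff_tendsto_dist_atTop_0.1 (h.tendsto_apply x y hxy).cauchySeq).const_mul
      (t : ℝ)
    rw [mul_zero] at hY
    refine squeeze_zero_norm (fun n => ?_) hY
    rw [dist_eq_norm]
    exact norm_exp_sub_exp_apply_le (h.commute _ _) (h.norm_exp_le _) (h.norm_exp_le _) x t.2
  choose F hF using fun t x => cauchySeq_tendsto_of_complete (hcauchy t x)
  exact ⟨fun t => continuousLinearMapOfTendsto (fun n => NormedSpace.exp ((t : ℝ) • Y n))
    (tendsto_pi_nhds.2 (hF t)), hF⟩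

variable (h : IsContractiveApproximation B Y)
  (hT : ∀ (t : ℝ≥0) x, Tendsto (fun n => NormedSpace.exp ((t : ℝ) • Y n) x) atTop (𝓝 (T t x)))
include h hT

theorem norm_sub_exp_le (hxy : (x, y) ∈ B.graph) (t : ℝ≥0) (n : ℕ) :
    ‖T t x - NormedSpace.exp ((t : ℝ) • Y n) x‖ ≤ t * ‖y - Y n x‖ :=
  le_of_tendsto_of_tendsto' ((hT t x).sub_const _).norm
    (((h.tendsto_apply x y hxy).sub_const _).norm.const_mul (t : ℝ)) fun m =>
      norm_exp_sub_exp_apply_le (h.commute m n) (h.norm_exp_le m) (h.norm_exp_le n) x t.2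

theorem map_add (s t : ℝ≥0) : T (s + t) = (T s).comp (T t) := by
  ext x
  set E : ℕ → ℝ≥0 → X →L[ℂ] X := fun n t => NormedSpace.exp ((t : ℝ) • Y n)
  have hlim : Tendsto (fun n => E n s (E n t x)) atTop (𝓝 (T s (T t x))) :=
    tendsto_apply_of_norm_le (fun n => h.norm_exp_le n s s.2) (hT t x) (hT s (T t x))
  refine tendsto_nhds_unique (hT (s + t) x) (hlim.congr fun n => ?_)
  rw [NNReal.coe_add, add_smul,
    exp_add_of_commute (((Commute.refl (Y n)).smul_left _).smul_right _)]
  rfl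

/-- The difference quotients of `e^{tY_n} x` converge uniformly in `t` to those of `T(t) x`. -/
theorem hasDerivWithinAt (hxy : (x, y) ∈ B.graph) :
    HasDerivWithinAt (fun t : ℝ => T t.toNNReal x) y (Ioi 0) 0 := by
  rw [hasDerivWithinAt_iff_tendsto_slope' self_notMem_Ioi]
  have hslope : ∀ n, Tendsto (slope (fun t : ℝ => NormedSpace.exp (t • Y n) x) 0) (𝓝[>] 0)
      (𝓝 (Y n x)) := fun n => by
    have := (hasDerivAt_exp_smul_apply (Y n) x 0).hasDerivWithinAt (s := Ioi 0)
    rw [hasDerivWithinAt_iff_tendsto_slope' self_notMem_Ioi] at this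
    simpa using this
  have hle : ∀ n, ∀ t : ℝ, 0 < t → dist (slope (fun t : ℝ => T t.toNNReal x) 0 t)
      (slope (fun t : ℝ => NormedSpace.exp (t • Y n) x) 0 t) ≤ dist (Y n x) y := fun n t ht => by
    have := h.norm_sub_exp_le hT hxy t.toNNReal n
    rw [Real.coe_toNNReal _ ht.le] at this
    rw [dist_comm (Y n x), dist_eq_norm, dist_eq_norm, slope_def_module, slope_def_module,
      ← smul_sub, norm_smul, norm_inv, sub_zero, Real.norm_of_nonneg ht.le, inv_mul_le_iff₀ ht]
    simpa [map_zero_of_tendsto_exp hT] using this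
  have hlim := h.tendsto_apply x y hxy
  have hunif : TendstoUniformlyOnFilter
      (fun n => slope (fun t : ℝ => NormedSpace.exp (t • Y n) x) 0)
      (slope (fun t : ℝ => T t.toNNReal x) 0) atTop (𝓝[>] 0) := by
    refine Metric.tendstoUniformlyOnFilter_iff.2 fun ε hε => ?_
    filter_upwards [((Metric.tendsto_nhds.1 hlim) ε hε).prod_mk self_mem_nhdsWithin]
      with p ⟨hp, ht⟩ using (hle p.1 p.2 ht).trans_lt hp
  exact hunif.tendsto_of_eventually_tendsto (Eventually.of_forall hslope) hlim

theorem isC0Semigroup (hB : Dense (B.domain : Set X)) : IsC0Semigroup T := by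
  have hzero := map_zero_of_tendsto_exp hT
  refine isC0Semigroup_of_tendsto hzero (h.map_add hT) (h.norm_le_one hT) hB fun x hx => ?_
  obtain ⟨y, hxy⟩ := LinearPMap.mem_domain_iff.1 hx
  have hcont : ContinuousWithinAt (fun t : ℝ => T t.toNNReal x) (Ici 0) 0 :=
    (continuousWithinAt_Ioi_iff_Ici).1 (h.hasDerivWithinAt hT hxy).continuousWithinAt
  have hcoe : Tendsto ((↑) : ℝ≥0 → ℝ) (𝓝 0) (𝓝[≥] 0) :=
    tendsto_nhdsWithin_iff.2 ⟨NNReal.continuous_coe.tendsto 0, Eventually.of_forall fun t => t.2⟩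
  simpa [Function.comp_def, hzero] using hcont.tendsto.comp hcoe

end IsContractiveApproximation

end Approximation

section HilleYosida

variable {X : Type*} [NormedAddCommGroup X] [NormedSpace ℂ X]
variable {A : X →ₗ.[ℂ] X} {Q : X →L[ℂ] X} {x y : X} {ω : ℝ}

/-- The Yosida approximation `a A R(a, A) = a (a R(a, A) - 1)`, given `R = R(a, A)`. -/
noncomputable def yosidaApprox (a : ℝ) (R : X →L[ℂ] X) : X →L[ℂ] X :=
  a • ((a : ℂ) • R - 1)

theorem yosidaApprox_apply {a : ℝ} {R : X →L[ℂ] X} (hR : IsResolvent A a R)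
    (hxy : (x, y) ∈ A.graph) : yosidaApprox a R x = (a : ℂ) • R y := by
  rw [← hR.smul_apply_sub hxy]
  simp [yosidaApprox]

theorem commute_yosidaApprox {R : X →L[ℂ] X} (h : Commute Q R) (a : ℝ) :
    Commute Q (yosidaApprox a R) :=
  ((h.smul_right _).sub_right (Commute.one_right _)).smul_right _

variable [CompleteSpace X]

theorem IsMDissipative.isContractiveApproximation (hA : Dense (A.domain : Set X))
    (h : IsMDissipative A 0) {a : ℕ → ℝ} (ha : ∀ n, 0 < a n) (hlim : Tendsto a atTop atTop)
    {R : ℕ → X →L[ℂ] X} (hR : ∀ n, IsResolvent A (a n) (R n)) :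
    IsContractiveApproximation A fun n => yosidaApprox (a n) (R n) := by
  have hcontr : ∀ n, ‖(a n : ℂ) • R n‖ ≤ 1 := fun n => by
    rw [norm_smul, Complex.norm_of_nonneg (ha n).le, ← le_div_iff₀' (ha n)]
    simpa using (hR n).norm_le_of_re_le h.re_le (by simpa using ha n)
  refine ⟨fun m n => ?_, fun n t ht => ?_, fun x y hxy => ?_⟩
  · exact commute_yosidaApprox
      (commute_yosidaApprox ((hR n).commute (hR m)) (a m)).symm (a n)
  · rw [yosidaApprox, smul_smul]
    exact norm_exp_smul_sub_one_le ContinuousLinearMap.norm_id_le (hcontr n)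
      (mul_nonneg ht (ha n).le)
  · have hcob : Tendsto (fun n => (a n : ℂ)) atTop (Bornology.cobounded ℂ) :=
      tendsto_norm_atTop_iff_cobounded.1
        (hlim.congr fun n => (Complex.norm_of_nonneg (ha n).le).symm)
    exact (tendsto_smul_resolvent_apply hA hcob (Eventually.of_forall hR)
      (Eventually.of_forall hcontr) y).congr fun n => (yosidaApprox_apply (hR n) hxy).symm

theorem IsMDissipative.exists_semigroup (hA : Dense (A.domain : Set X)) (h : IsMDissipative A 0) :
    ∃ T : ℝ≥0 → X →L[ℂ] X, IsC0Semigroup T ∧ IsGenerator A T ∧ (∀ t, ‖T t‖ ≤ 1) ∧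
      ∀ Q : X →L[ℂ] X, (∀ μ R, 0 < μ.re → IsResolvent A μ R → Commute Q R) →
        ∀ t, Commute Q (T t) := by
  let a : ℕ → ℝ := fun n => n + 1
  have ha : ∀ n, 0 < a n := fun n => Nat.cast_add_one_pos n
  choose R hR using fun n => h.mem_resolventSet (a n) (by simpa using ha n)
  have happrox := h.isContractiveApproximation hA ha
    (tendsto_atTop_add_const_right _ 1 tendsto_natCast_atTop_atTop) hR
  obtain ⟨T, hT⟩ := happrox.exists_tendsto_exp hA
  have hT1 := happrox.norm_le_one hT
  refine ⟨T, happrox.isC0Semigroup hT hA, ?_, hT1, fun Q hQ t => ?_⟩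
  · exact isGenerator_of_forall_mem_graph (ω := 0) (map_zero_of_tendsto_exp hT)
      (by simpa using hT1) (fun x y => happrox.hasDerivWithinAt hT) (by simpa using ha 0) (hR 0)
  · ext x
    have hcomm : ∀ n, Commute Q (NormedSpace.exp ((t : ℝ) • yosidaApprox (a n) (R n))) :=
      fun n =>
        ((commute_yosidaApprox (hQ _ _ (by simpa using ha n) (hR n)) _).smul_right _).exp_right
    exact tendsto_nhds_unique ((Q.continuous.tendsto _).comp (hT t x))
      ((hT t (Q x)).congr fun n => DFunLike.congr_fun (hcomm n).eq.symm x)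

theorem generatesContractive_iff_isMDissipative (hA : Dense (A.domain : Set X)) :
    GeneratesContractive A ω ↔ IsMDissipative A ω := by
  refine ⟨GeneratesContractive.isMDissipative, fun h => ?_⟩
  obtain ⟨T, hT, hgen, hT1, -⟩ := IsMDissipative.exists_semigroup (A := shift ω A) hA
    (by simpa using h.shift ω)
  refine ⟨expScale (-ω) T, hT.expScale _, ?_, fun t => ?_⟩
  · simpa only [shift_neg_shift] using hgen.expScale hT.map_zero (-ω)
  · simpa using norm_expScale_le (w := -ω) (ω := 0) (by simpa using hT1) t

end HilleYosida

section CommutingPairs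

variable {X : Type*} [NormedAddCommGroup X] [NormedSpace ℂ X]
variable {A : X →ₗ.[ℂ] X} {c₁ c₂ μ ν : ℂ} {R S : X →L[ℂ] X}
variable {S₁ S₂ : ℝ≥0 → X →L[ℂ] X} {x y₁ y₂ : X}

theorem IsResolvent.commute_of_smul (hc₁ : c₁ ≠ 0) (hc₂ : c₂ ≠ 0)
    (hR : IsResolvent (c₁ • A) μ R) (hS : IsResolvent (c₂ • A) ν S) : Commute R S := by
  rw [← mul_div_cancel₀ μ hc₁, isResolvent_smul_iff hc₁] at hR
  rw [← mul_div_cancel₀ ν hc₂, isResolvent_smul_iff hc₂] at hS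
  exact (Commute.smul_right_iff₀ hc₂).1 ((Commute.smul_left_iff₀ hc₁).1 (hR.commute hS))

/-- A pair of commuting `C₀`-semigroups of contractions. The operators `S₁ s ∘ S₂ t` form a
two-parameter semigroup, from which the isometric groups and the analytic semigroups below are
obtained. -/
structure IsCommutingPair (S₁ S₂ : ℝ≥0 → X →L[ℂ] X) : Prop where
  left : IsC0Semigroup S₁
  right : IsC0Semigroup S₂
  norm_left_le : ∀ t, ‖S₁ t‖ ≤ 1
  norm_right_le : ∀ t, ‖S₂ t‖ ≤ 1
  commute : ∀ s t, Commute (S₁ s) (S₂ t)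

theorem exists_isCommutingPair [CompleteSpace X] (hA : Dense (A.domain : Set X)) (hc₁ : c₁ ≠ 0)
    (hc₂ : c₂ ≠ 0) (h₁ : IsMDissipative (c₁ • A) 0) (h₂ : IsMDissipative (c₂ • A) 0) :
    ∃ S₁ S₂ : ℝ≥0 → X →L[ℂ] X, IsCommutingPair S₁ S₂ ∧ IsGenerator (c₁ • A) S₁ ∧
      IsGenerator (c₂ • A) S₂ := by
  obtain ⟨S₁, hS₁, hgen₁, hle₁, hcomm₁⟩ := h₁.exists_semigroup (A := c₁ • A) hA
  obtain ⟨S₂, hS₂, hgen₂, hle₂, hcomm₂⟩ := h₂.exists_semigroup (A := c₂ • A) hA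
  refine ⟨S₁, S₂, ⟨hS₁, hS₂, hle₁, hle₂, fun s t => ?_⟩, hgen₁, hgen₂⟩
  exact (hcomm₁ _ (fun μ R _ hR => (hcomm₂ R
    (fun ν R' _ hR' => hR.commute_of_smul hc₁ hc₂ hR') t).symm) s).symm

namespace IsCommutingPair

theorem apply_comm (h : IsCommutingPair S₁ S₂) (s t : ℝ≥0) (x : X) :
    S₁ s (S₂ t x) = S₂ t (S₁ s x) :=
  DFunLike.congr_fun (h.commute s t).eq x

theorem apply_add_apply_add (h : IsCommutingPair S₁ S₂) (s s' t t' : ℝ≥0) (x : X) :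
    S₁ (s + s') (S₂ (t + t') x) = S₁ s (S₂ t (S₁ s' (S₂ t' x))) := by
  rw [← h.apply_comm s' t, ← h.left.apply_add, ← h.right.apply_add]

theorem norm_comp_le (h : IsCommutingPair S₁ S₂) (s t : ℝ≥0) : ‖(S₁ s).comp (S₂ t)‖ ≤ 1 :=
  ((S₁ s).opNorm_comp_le _).trans
    (mul_le_one₀ (h.norm_left_le s) (norm_nonneg _) (h.norm_right_le t))

theorem continuous_apply_apply (h : IsCommutingPair S₁ S₂) (x : X) :
    Continuous fun p : ℝ≥0 × ℝ≥0 => S₁ p.1 (S₂ p.2 x) :=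
  continuous_iff_continuousAt.2 fun p =>
    tendsto_apply_of_norm_le (fun q : ℝ≥0 × ℝ≥0 => h.norm_left_le q.1)
      (((h.right.continuous_orbit x).comp continuous_snd).tendsto p)
      (((h.left.continuous_orbit (S₂ p.2 x)).comp continuous_fst).tendsto p)

theorem isC0Semigroup (h : IsCommutingPair S₁ S₂) :
    IsC0Semigroup fun t => (S₁ t).comp (S₂ t) where
  map_zero := by rw [h.left.map_zero, h.right.map_zero, ContinuousLinearMap.id_comp]
  map_add s t := ContinuousLinearMap.ext fun x => h.apply_add_apply_add s t s t x
  continuous_orbit x := (h.continuous_apply_apply x).comp (continuous_id.prodMk continuous_id)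

theorem hasDerivWithinAt (h : IsCommutingPair S₁ S₂)
    (h₁ : HasDerivWithinAt (fun t : ℝ => S₁ t.toNNReal x) y₁ (Ioi 0) 0)
    (h₂ : HasDerivWithinAt (fun t : ℝ => S₂ t.toNNReal x) y₂ (Ioi 0) 0) :
    HasDerivWithinAt (fun t : ℝ => S₁ t.toNNReal (S₂ t.toNNReal x)) (y₁ + y₂) (Ioi 0) 0 := by
  rw [hasDerivWithinAt_iff_tendsto_slope' self_notMem_Ioi] at h₁ h₂ ⊢
  have hy₂ : Tendsto (fun t : ℝ => S₁ t.toNNReal y₂) (𝓝[>] 0) (𝓝 y₂) := by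
    simpa [h.left.map_zero] using
      ((h.left.continuous_toNNReal y₂).tendsto 0).mono_left nhdsWithin_le_nhds
  refine (h₁.add (tendsto_apply_of_norm_le (fun t : ℝ => h.norm_left_le t.toNNReal) h₂
    hy₂)).congr fun t => ?_
  simp only [slope_def_module, Real.toNNReal_zero, h.left.map_zero, h.right.map_zero,
    ContinuousLinearMap.id_apply, ContinuousLinearMap.map_smul_of_tower, map_sub, ← smul_add,
    sub_add_sub_cancel']

end IsCommutingPair

end CommutingPairs

section IsometricGroups

variable {X : Type*} [NormedAddCommGroup X] [NormedSpace ℂ X]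
variable {A : X →ₗ.[ℂ] X} {U : ℝ → X →L[ℂ] X} {S₁ S₂ : ℝ≥0 → X →L[ℂ] X} {x y : X}

theorem IsC0Semigroup.apply_eq_self (hS : IsC0Semigroup S₁)
    (hx : HasDerivWithinAt (fun t : ℝ => S₁ t.toNNReal x) 0 (Ioi 0) 0) (t : ℝ≥0) : S₁ t x = x := by
  have hder : ∀ s ∈ Ico (0 : ℝ) t, HasDerivWithinAt (fun t : ℝ => S₁ t.toNNReal x) 0 (Ici s) s :=
    fun s hs => by simpa using (hS.hasDerivWithinAt hx hs.1).Ici_of_Ioi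
  simpa [hS.map_zero] using constant_of_has_deriv_right_zero
    (hS.continuous_toNNReal x).continuousOn hder t ⟨t.2, le_rfl⟩

theorem mem_graph_neg_iff : (x, -y) ∈ (-A).graph ↔ (x, y) ∈ A.graph := by
  simp only [LinearPMap.mem_graph_iff, LinearPMap.neg_apply, neg_inj, LinearPMap.neg_domain]

/-- A strongly continuous one-parameter group of isometries. -/
structure IsIsometricGroup (U : ℝ → X →L[ℂ] X) : Prop where
  map_zero : U 0 = ContinuousLinearMap.id ℂ X
  map_add : ∀ s t, U (s + t) = (U s).comp (U t)
  continuous_orbit : ∀ x, Continuous fun t => U t x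
  norm_apply : ∀ t x, ‖U t x‖ = ‖x‖

namespace IsIsometricGroup

theorem apply_add (hU : IsIsometricGroup U) (s t : ℝ) (x : X) : U (s + t) x = U s (U t x) := by
  rw [hU.map_add, ContinuousLinearMap.comp_apply]

theorem norm_le_one (hU : IsIsometricGroup U) (t : ℝ) : ‖U t‖ ≤ 1 :=
  (U t).opNorm_le_bound zero_le_one fun x => (hU.norm_apply t x).trans_le (one_mul _).ge

theorem comp_neg (hU : IsIsometricGroup U) : IsIsometricGroup fun t => U (-t) where
  map_zero := by simpa using hU.map_zero
  map_add s t := by rw [neg_add, hU.map_add]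
  continuous_orbit x := (hU.continuous_orbit x).comp continuous_neg
  norm_apply t := hU.norm_apply (-t)

theorem isC0Semigroup (hU : IsIsometricGroup U) : IsC0Semigroup fun t : ℝ≥0 => U t where
  map_zero := hU.map_zero
  map_add s t := by rw [NNReal.coe_add, hU.map_add]
  continuous_orbit x := (hU.continuous_orbit x).comp NNReal.continuous_coe

theorem slope_neg (hU : IsIsometricGroup U) (x : X) (t : ℝ) :
    slope (fun t => U t x) 0 (-t) = U (-t) (slope (fun t => U t x) 0 t) := by
  have hinv : U (-t) (U t x) = x := by
    rw [← hU.apply_add, neg_add_cancel, hU.map_zero, ContinuousLinearMap.id_apply]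
  rw [slope_def_module, slope_def_module, ContinuousLinearMap.map_smul_of_tower, map_sub, hinv,
    hU.map_zero, ContinuousLinearMap.id_apply, sub_zero, sub_zero, inv_neg, neg_smul, ← smul_neg,
    neg_sub]

theorem hasDerivAt_zero_iff (hU : IsIsometricGroup U) :
    HasDerivAt (fun t => U t x) y 0 ↔ HasDerivWithinAt (fun t => U t x) y (Ioi 0) 0 := by
  refine ⟨HasDerivAt.hasDerivWithinAt, fun h => ?_⟩
  rw [hasDerivWithinAt_iff_tendsto_slope' self_notMem_Ioi] at h
  have hneg : Tendsto (fun t : ℝ => -t) (𝓝[<] 0) (𝓝[>] 0) := by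
    simpa using tendsto_neg_nhdsLT (a := (0 : ℝ))
  have hy : Tendsto (fun t => U t y) (𝓝[<] 0) (𝓝 y) := by
    simpa [hU.map_zero] using ((hU.continuous_orbit y).tendsto 0).mono_left nhdsWithin_le_nhds
  rw [hasDerivAt_iff_tendsto_slope, ← Iio_union_Ioi, nhdsWithin_union]
  refine Tendsto.sup ?_ h
  refine (tendsto_apply_of_norm_le hU.norm_le_one (h.comp hneg) hy).congr fun t => ?_
  simpa using (hU.slope_neg x (-t)).symm

theorem isGenerator_iff (hU : IsIsometricGroup U) :
    IsGenerator A (fun t : ℝ≥0 => U t) ↔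
      ∀ x y, (x, y) ∈ A.graph ↔ HasDerivAt (fun t => U t x) y 0 := by
  simp only [isGenerator_coe_iff_hasDerivWithinAt hU.map_zero, hU.hasDerivAt_zero_iff]

end IsIsometricGroup

theorem generatesIsometricGroup_iff_isGenerator :
    GeneratesIsometricGroup A ↔ ∃ U, IsIsometricGroup U ∧ IsGenerator A fun t : ℝ≥0 => U t := by
  have hlimit : ∀ U : ℝ → X →L[ℂ] X, U 0 = ContinuousLinearMap.id ℂ X → ∀ x y,
      Tendsto (fun t : ℝ => ((t : ℂ)⁻¹) • (U t x - x)) (𝓝[≠] 0) (𝓝 y) ↔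
        HasDerivAt (fun t => U t x) y 0 := by
    intro U hzero x y
    rw [hasDerivAt_iff_tendsto_slope]
    refine tendsto_congr fun t => ?_
    rw [slope_def_module, sub_zero, ← Complex.ofReal_inv, Complex.coe_smul, hzero,
      ContinuousLinearMap.id_apply]
  constructor
  · rintro ⟨U, hzero, hadd, hcont, hgen, hnorm⟩
    have hU : IsIsometricGroup U := ⟨hzero, hadd, hcont, hnorm⟩
    exact ⟨U, hU, hU.isGenerator_iff.2 fun x y => (hgen x y).trans (hlimit U hzero x y)⟩
  · rintro ⟨U, hU, hgen⟩
    exact ⟨U, hU.map_zero, hU.map_add, hU.continuous_orbit, fun x y =>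
      (hU.isGenerator_iff.1 hgen x y).trans (hlimit U hU.map_zero x y).symm, hU.norm_apply⟩

theorem GeneratesIsometricGroup.generatesContractive (h : GeneratesIsometricGroup A) :
    GeneratesContractive A 0 := by
  obtain ⟨U, hU, hgen⟩ := generatesIsometricGroup_iff_isGenerator.1 h
  exact ⟨_, hU.isC0Semigroup, hgen, fun t => by simpa using hU.norm_le_one t⟩

theorem GeneratesIsometricGroup.neg (h : GeneratesIsometricGroup A) :
    GeneratesIsometricGroup (-A) := by
  obtain ⟨U, hU, hgen⟩ := generatesIsometricGroup_iff_isGenerator.1 h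
  refine generatesIsometricGroup_iff_isGenerator.2
    ⟨_, hU.comp_neg, hU.comp_neg.isGenerator_iff.2 fun x y => ?_⟩
  have hreflect : ∀ (u : ℝ → X) (v : X), HasDerivAt u v 0 →
      HasDerivAt (fun t => u (-t)) (-v) 0 := fun u v hu => by
    simpa using HasDerivAt.comp_const_sub (f := u) (0 : ℝ) 0 (by simpa using hu)
  rw [← neg_neg y, mem_graph_neg_iff, hU.isGenerator_iff.1 hgen]
  exact ⟨hreflect _ _, fun h => by simpa using hreflect _ _ h⟩

/-- The group `U(t) = S₁(t)`, `U(-t) = S₂(t)` for `t ≥ 0`, if `S₂` is inverse to `S₁`. Writing it as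
a product makes the group law an instance of the two-parameter semigroup law. -/
noncomputable def toGroup (S₁ S₂ : ℝ≥0 → X →L[ℂ] X) (t : ℝ) : X →L[ℂ] X :=
  (S₁ t.toNNReal).comp (S₂ (-t).toNNReal)

namespace IsCommutingPair

theorem apply_apply_self (h : IsCommutingPair S₁ S₂)
    (hA : Dense (A.domain : Set X)) (h₁ : IsGenerator A S₁) (h₂ : IsGenerator (-A) S₂) (t : ℝ≥0)
    (x : X) : S₁ t (S₂ t x) = x := by
  have heq : EqOn ((S₁ t).comp (S₂ t)) id A.domain := fun x hx => by
    obtain ⟨y, hxy⟩ := LinearPMap.mem_domain_iff.1 hx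
    refine h.isC0Semigroup.apply_eq_self ?_ t
    simpa using h.hasDerivWithinAt
      (((isGenerator_iff_hasDerivWithinAt h.left.map_zero).1 h₁ x y).1 hxy)
      (((isGenerator_iff_hasDerivWithinAt h.right.map_zero).1 h₂ x (-y)).1
        (mem_graph_neg_iff.2 hxy))
  exact congrFun (Continuous.ext_on hA (map_continuous _) continuous_id heq) x

theorem apply_apply_eq_of_add_eq (h : IsCommutingPair S₁ S₂) (hinv : ∀ t x, S₁ t (S₂ t x) = x)
    {s t s' t' : ℝ≥0} (hst : s + t' = s' + t) (x : X) : S₁ s (S₂ t x) = S₁ s' (S₂ t' x) :=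
  calc S₁ s (S₂ t x) = S₁ (s + t') (S₂ (t + t') x) := by rw [h.apply_add_apply_add, hinv]
    _ = S₁ (s' + t) (S₂ (t' + t) x) := by rw [hst, add_comm t]
    _ = S₁ s' (S₂ t' x) := by rw [h.apply_add_apply_add, hinv]

theorem isIsometricGroup (h : IsCommutingPair S₁ S₂) (hinv : ∀ t x, S₁ t (S₂ t x) = x) :
    IsIsometricGroup (toGroup S₁ S₂) := by
  have hzero : toGroup S₁ S₂ 0 = ContinuousLinearMap.id ℂ X := by
    simp [toGroup, h.left.map_zero, h.right.map_zero]
  have hadd : ∀ s t, toGroup S₁ S₂ (s + t) = (toGroup S₁ S₂ s).comp (toGroup S₁ S₂ t) := by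
    intro s t
    ext x
    refine (h.apply_apply_eq_of_add_eq hinv ?_ x).trans (h.apply_add_apply_add _ _ _ _ x)
    rw [← NNReal.coe_inj]
    push_cast [Real.coe_toNNReal']
    linarith [max_zero_sub_eq_self s, max_zero_sub_eq_self t, max_zero_sub_eq_self (s + t)]
  have hle : ∀ t x, ‖toGroup S₁ S₂ t x‖ ≤ ‖x‖ := fun t x =>
    ((toGroup S₁ S₂ t).le_of_opNorm_le (h.norm_comp_le _ _) x).trans_eq (one_mul _)
  refine ⟨hzero, hadd, fun x => ?_, fun t x => (hle t x).antisymm ?_⟩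
  · exact (h.continuous_apply_apply x).comp
      (by fun_prop : Continuous fun t : ℝ => (t.toNNReal, (-t).toNNReal))
  · calc ‖x‖ = ‖toGroup S₁ S₂ (-t) (toGroup S₁ S₂ t x)‖ := by
          rw [← ContinuousLinearMap.comp_apply, ← hadd, neg_add_cancel, hzero,
            ContinuousLinearMap.id_apply]
      _ ≤ ‖toGroup S₁ S₂ t x‖ := hle _ _

end IsCommutingPair

theorem generatesIsometricGroup_iff_isMDissipative [CompleteSpace X]
    (hA : Dense (A.domain : Set X)) :
    GeneratesIsometricGroup A ↔ IsMDissipative A 0 ∧ IsMDissipative (-A) 0 := by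
  refine ⟨fun h => ⟨h.generatesContractive.isMDissipative,
    h.neg.generatesContractive.isMDissipative⟩, fun ⟨hpos, hneg⟩ => ?_⟩
  have hsmul : (-1 : ℂ) • A = -A := LinearPMap.ext rfl fun x hx _ => neg_one_smul ℂ (A ⟨x, hx⟩)
  obtain ⟨S₁, S₂, h, hgen₁, hgen₂⟩ := exists_isCommutingPair (c₁ := 1) (c₂ := -1) hA one_ne_zero
    (neg_ne_zero.2 one_ne_zero) (by rwa [one_smul]) (by rwa [hsmul])
  rw [one_smul] at hgen₁
  rw [hsmul] at hgen₂
  have hS₁ : (fun t : ℝ≥0 => toGroup S₁ S₂ t) = S₁ := funext fun t => by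
    rw [toGroup, Real.toNNReal_coe, Real.toNNReal_of_nonpos (neg_nonpos.2 t.coe_nonneg),
      h.right.map_zero, ContinuousLinearMap.comp_id]
  exact generatesIsometricGroup_iff_isGenerator.2
    ⟨_, h.isIsometricGroup (h.apply_apply_self hA hgen₁ hgen₂), by rwa [hS₁]⟩

end IsometricGroups

section StrongHolomorphy

variable {X Y : Type*} [NormedAddCommGroup X] [NormedSpace ℂ X] [NormedAddCommGroup Y]
  [NormedSpace ℂ Y] {U : Set ℂ} {T : ℂ → X →L[ℂ] Y} {C : ℝ}

theorem continuousOn_of_forall_differentiableOn_apply (hU : IsOpen U) (hC : ∀ z, ‖T z‖ ≤ C)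
    (h : ∀ x, DifferentiableOn ℂ (fun z => T z x) U) : ContinuousOn T U := by
  intro z hz
  obtain ⟨r, hr, hball⟩ := Metric.isOpen_iff.1 hU z hz
  have hC₀ : 0 ≤ C := (norm_nonneg _).trans (hC z)
  refine (continuousAt_of_locally_lipschitz hr (2 * C / r) fun w hw => ?_).continuousWithinAt
  rw [dist_eq_norm]
  refine ContinuousLinearMap.opNorm_le_bound _ (by positivity) fun x => ?_
  have hmaps : MapsTo (fun z => T z x) (Metric.ball z r)
      (Metric.closedBall (T z x) (2 * C * ‖x‖)) := fun w _ => by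
    rw [mem_closedBall_iff_norm]
    calc ‖T w x - T z x‖ ≤ C * ‖x‖ + C * ‖x‖ := norm_sub_le_of_le
          ((T w).le_of_opNorm_le (hC w) x) ((T z).le_of_opNorm_le (hC z) x)
      _ = 2 * C * ‖x‖ := by ring
  calc ‖(T w - T z) x‖ = dist (T w x) (T z x) := by rw [dist_eq_norm, sub_apply]
    _ ≤ 2 * C * ‖x‖ / r * dist w z :=
      Complex.dist_le_div_mul_dist_of_mapsTo_ball ((h x).mono hball) hmaps hw
    _ = 2 * C / r * dist w z * ‖x‖ := by ring

theorem wedgeIntegral_apply {z w : ℂ} (hT : ContinuousOn T (Complex.Rectangle z w)) (x : X) :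
    Complex.wedgeIntegral z w (fun v => T v x) = Complex.wedgeIntegral z w T x := by
  have hre : ContinuousOn (fun t : ℝ => T (t + z.im * I)) (uIcc z.re w.re) :=
    hT.comp (by fun_prop) fun t ht => by simpa [Complex.Rectangle, Complex.mem_reProdIm] using ht
  have him : ContinuousOn (fun t : ℝ => T (w.re + t * I)) (uIcc z.im w.im) :=
    hT.comp (by fun_prop) fun t ht => by simpa [Complex.Rectangle, Complex.mem_reProdIm] using ht
  rw [Complex.wedgeIntegral, Complex.wedgeIntegral, add_apply, smul_apply,
    ContinuousLinearMap.intervalIntegral_apply hre.intervalIntegrable,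
    ContinuousLinearMap.intervalIntegral_apply him.intervalIntegrable]

variable [CompleteSpace Y]

theorem differentiableOn_of_forall_differentiableOn_apply (hU : IsOpen U) (hC : ∀ z, ‖T z‖ ≤ C)
    (h : ∀ x, DifferentiableOn ℂ (fun z => T z x) U) : DifferentiableOn ℂ T U := by
  have hcont := continuousOn_of_forall_differentiableOn_apply hU hC h
  refine (Complex.isConservativeOn_and_continuousOn_iff_isDifferentiableOn hU).1
    ⟨fun z w hzw => ?_, hcont⟩
  have hwz : Complex.Rectangle w z ⊆ U := by
    rwa [Complex.Rectangle, uIcc_comm w.re, uIcc_comm w.im]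
  ext x
  rw [neg_apply, ← wedgeIntegral_apply (hcont.mono hzw), ← wedgeIntegral_apply (hcont.mono hwz)]
  exact (h x).isConservativeOn z w hzw

end StrongHolomorphy

section Rays

variable {X : Type*} [NormedAddCommGroup X] [NormedSpace ℂ X]
variable {A : X →ₗ.[ℂ] X} {T : ℂ → X →L[ℂ] X} {c c' z : ℂ} {δ t ω : ℝ} {x y : X}

theorem isOpen_openSector (hδ : δ ≤ Real.pi) : IsOpen (openSector δ) := by
  refine isOpen_iff_mem_nhds.2 fun z ⟨hz, harg⟩ => ?_
  have hslit : z ∈ Complex.slitPlane := Complex.mem_slitPlane_iff_arg.2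
    ⟨((le_abs_self _).trans_lt (harg.trans_le hδ)).ne, hz⟩
  filter_upwards [(Complex.continuousAt_arg hslit).abs.eventually_lt_const harg,
    isOpen_ne.mem_nhds hz] with w hw hw₀ using ⟨hw₀, hw⟩

theorem mul_real_mem_openSector (hc : c ∈ openSector δ) (ht : 0 < t) : c * t ∈ openSector δ := by
  refine ⟨mul_ne_zero hc.1 (Complex.ofReal_ne_zero.2 ht.ne'), ?_⟩
  rw [mul_comm, Complex.arg_real_mul _ ht]
  exact hc.2

theorem one_mem_openSector (hδ : 0 < δ) : 1 ∈ openSector δ :=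
  ⟨one_ne_zero, by simpa using hδ⟩

theorem hasDerivWithinAt_ray (hzero : T 0 = ContinuousLinearMap.id ℂ X)
    (h : ∀ t : ℝ, 0 < t → HasDerivAt (fun z => T z x) (T (c * t) y) (c * t))
    (hx : Tendsto (fun t : ℝ => T (c * t) x) (𝓝[>] 0) (𝓝 x))
    (hy : Tendsto (fun t : ℝ => T (c * t) y) (𝓝[>] 0) (𝓝 y)) :
    HasDerivWithinAt (fun t : ℝ => T (c * t) x) (c • y) (Ioi 0) 0 := by
  have hderiv : ∀ t : ℝ, 0 < t → HasDerivAt (fun t : ℝ => T (c * t) x) (c • T (c * t) y) t := by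
    intro t ht
    have hmul : HasDerivAt (fun t : ℝ => c * (t : ℂ)) c t := by
      simpa using ((hasDerivAt_id (t : ℂ)).const_mul c).comp_ofReal
    exact HasDerivAt.scomp (g₁ := fun z => T z x) t (h t ht) hmul
  refine (hasDerivWithinAt_Ici_of_tendsto_deriv (s := Ioi 0)
    (fun t ht => (hderiv t ht).differentiableAt.differentiableWithinAt)
    (by simpa [ContinuousWithinAt, hzero] using hx) self_mem_nhdsWithin
    ((hy.const_smul c).congr' ?_)).mono Ioi_subset_Ici_self
  filter_upwards [self_mem_nhdsWithin] with t ht using (hderiv t ht).deriv.symm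

namespace IsAnalyticSemigroup

theorem tendsto_ray (hT : IsAnalyticSemigroup δ T) (hc : c ∈ openSector δ) (x : X) :
    Tendsto (fun t : ℝ => T (c * t) x) (𝓝[>] 0) (𝓝 x) := by
  obtain ⟨δ', hlt, hδ'⟩ := exists_between hc.2
  have hray : Tendsto (fun t : ℝ => c * t) (𝓝[>] 0) (𝓝 0) := by
    simpa using ((by fun_prop : Continuous fun t : ℝ => c * t).tendsto 0).mono_left
      nhdsWithin_le_nhds
  exact (hT.tendsto_zero δ' ((abs_nonneg _).trans_lt hlt) hδ' x).comp
    (tendsto_nhdsWithin_iff.2 ⟨hray,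
      eventually_nhdsWithin_of_forall fun t ht => mul_real_mem_openSector ⟨hc.1, hlt⟩ ht⟩)

theorem continuous_ray (hT : IsAnalyticSemigroup δ T) (hδ : δ ≤ Real.pi) (hc : c ∈ openSector δ)
    (x : X) : Continuous fun t : ℝ≥0 => T (c * (t : ℝ)) x := by
  refine continuous_iff_continuousAt.2 fun t => ?_
  rcases eq_zero_or_pos t with rfl | ht
  · refine ContinuousWithinAt.continuousAt (s := Ici 0) (continuousWithinAt_Ioi_iff_Ici.1 ?_)
      (by simp)
    have hlim := hT.tendsto_ray hc x
    rw [← map_coe_nhdsGT_zero, tendsto_map'_iff] at hlim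
    simpa [ContinuousWithinAt, hT.map_zero, Function.comp_def] using hlim
  · have hcont : ContinuousAt T (c * (t : ℝ)) := (hT.differentiableOn.differentiableAt
      ((isOpen_openSector hδ).mem_nhds (mul_real_mem_openSector hc ht))).continuousAt
    exact (ContinuousAt.comp (f := fun t : ℝ≥0 => c * ((t : ℝ) : ℂ)) hcont
      (by fun_prop)).clm_apply continuousAt_const

theorem isC0Semigroup_ray (hT : IsAnalyticSemigroup δ T) (hδ : δ ≤ Real.pi)
    (hc : c ∈ openSector δ) : IsC0Semigroup fun t : ℝ≥0 => T (c * (t : ℝ)) where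
  map_zero := by simp [hT.map_zero]
  map_add s t := by
    rcases eq_zero_or_pos s with rfl | hs
    · simp [hT.map_zero]
    rcases eq_zero_or_pos t with rfl | ht
    · simp [hT.map_zero]
    rw [NNReal.coe_add, Complex.ofReal_add, mul_add,
      hT.map_add _ (mul_real_mem_openSector hc (NNReal.coe_pos.2 hs)) _
        (mul_real_mem_openSector hc (NNReal.coe_pos.2 ht))]
  continuous_orbit := hT.continuous_ray hδ hc

theorem hasDerivAt (hT : IsAnalyticSemigroup δ T) (hδ : δ ≤ Real.pi) (hc : c ∈ openSector δ)
    (h : HasDerivWithinAt (fun t : ℝ => T (c * t) x) (c • y) (Ioi 0) 0) (hz : z ∈ openSector δ) :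
    HasDerivAt (fun z => T z x) (T z y) z := by
  have hderiv : HasDerivAt (fun z => T z x) (deriv T z x) z := by
    simpa using (hT.differentiableOn.differentiableAt
      ((isOpen_openSector hδ).mem_nhds hz)).hasDerivAt.clm_apply (hasDerivAt_const z x)
  have hline : HasDerivAt (fun t : ℝ => z + c * (t : ℂ)) c 0 := by
    simpa using (((hasDerivAt_id ((0 : ℝ) : ℂ)).const_mul c).const_add z).comp_ofReal
  have hleft : HasDerivAt (fun t : ℝ => T (z + c * t) x) (c • deriv T z x) 0 :=
    HasDerivAt.scomp (g₁ := fun z => T z x) (0 : ℝ) (by simpa using hderiv) hline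
  have hright : HasDerivWithinAt (fun t : ℝ => T (z + c * t) x) (T z (c • y)) (Ioi 0) 0 :=
    (((T z).restrictScalars ℝ).hasFDerivAt.comp_hasDerivWithinAt 0 h).congr
      (fun t ht => DFunLike.congr_fun (hT.map_add z hz _ (mul_real_mem_openSector hc ht)) x)
      (by simp [hT.map_zero])
  have heq := (uniqueDiffWithinAt_Ioi (0 : ℝ)).eq_deriv _ hleft.hasDerivWithinAt hright
  rw [map_smul] at heq
  rwa [smul_right_injective X hc.1 heq] at hderiv

theorem hasDerivWithinAt_ray (hT : IsAnalyticSemigroup δ T) (hδ : δ ≤ Real.pi)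
    (hc : c ∈ openSector δ) (hc' : c' ∈ openSector δ)
    (h : HasDerivWithinAt (fun t : ℝ => T (c * t) x) (c • y) (Ioi 0) 0) :
    HasDerivWithinAt (fun t : ℝ => T (c' * t) x) (c' • y) (Ioi 0) 0 :=
  NumericalSpectrum.hasDerivWithinAt_ray hT.map_zero
    (fun _ ht => hT.hasDerivAt hδ hc h (mul_real_mem_openSector hc' ht))
    (hT.tendsto_ray hc' x) (hT.tendsto_ray hc' y)

theorem isGenerator_ray (hT : IsAnalyticSemigroup δ T) (hδ : δ ≤ Real.pi) (hδ₀ : 0 < δ)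
    (hA : IsGenerator A fun t : ℝ≥0 => T (t : ℝ)) (hc : c ∈ openSector δ) :
    IsGenerator (c • A) fun t : ℝ≥0 => T (c * (t : ℝ)) := by
  have hone := one_mem_openSector hδ₀
  rw [isGenerator_coe_iff_hasDerivWithinAt (U := fun t => T t) (by simp [hT.map_zero])] at hA
  refine (isGenerator_coe_iff_hasDerivWithinAt (U := fun t => T (c * t))
    (by simp [hT.map_zero])).2 fun x y => ?_
  rw [← smul_inv_smul₀ hc.1 y, mem_graph_smul_iff hc.1, hA]
  refine ⟨fun h => hT.hasDerivWithinAt_ray hδ hone hc (by simpa using h), fun h => ?_⟩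
  simpa using hT.hasDerivWithinAt_ray hδ hc hone h

end IsAnalyticSemigroup

theorem GeneratesAnalyticContractive.exists_generatesContractive_smul
    (h : GeneratesAnalyticContractive A ω) : ∃ δ : ℝ, 0 < δ ∧ δ ≤ Real.pi / 2 ∧
      ∀ c ∈ openSector δ, GeneratesContractive (c • A) (ω * c.re) := by
  obtain ⟨δ, hδ₀, hδ, T, hT, hA, hω⟩ := h
  have hδπ : δ ≤ Real.pi := hδ.trans (half_le_self Real.pi_pos.le)
  refine ⟨δ, hδ₀, hδ, fun c hc => ⟨_, hT.isC0Semigroup_ray hδπ hc,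
    hT.isGenerator_ray hδπ hδ₀ hA hc, fun t => ?_⟩⟩
  rcases eq_zero_or_pos t with rfl | ht
  · simpa [hT.map_zero] using ContinuousLinearMap.norm_id_le (𝕜 := ℂ) (E := X)
  · simpa [mul_assoc] using hω _ (mul_real_mem_openSector hc (NNReal.coe_pos.2 ht))

end Rays

section SectorCoordinates

variable {c z : ℂ}

/-- The coordinates of a complex number in the real basis `c, conj c` of `ℂ`, which exists when
neither the real nor the imaginary part of `c` vanishes. -/
noncomputable def sectorCoord (c : ℂ) : ℂ →L[ℝ] ℝ × ℝ :=
  ((2 : ℝ)⁻¹ • (c.re⁻¹ • Complex.reCLM + c.im⁻¹ • Complex.imCLM)).prod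
    ((2 : ℝ)⁻¹ • (c.re⁻¹ • Complex.reCLM - c.im⁻¹ • Complex.imCLM))

theorem sectorCoord_apply (c z : ℂ) : sectorCoord c z =
    (2⁻¹ * (c.re⁻¹ * z.re + c.im⁻¹ * z.im), 2⁻¹ * (c.re⁻¹ * z.re - c.im⁻¹ * z.im)) := rfl

theorem sectorCoord_fst_mul_add_snd_mul_conj (hre : c.re ≠ 0) (him : c.im ≠ 0) (z : ℂ) :
    ((sectorCoord c z).1 : ℂ) * c + ((sectorCoord c z).2 : ℂ) * conj c = z := by
  apply Complex.ext <;>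
  · simp only [sectorCoord_apply, Complex.add_re, Complex.add_im, Complex.re_ofReal_mul,
      Complex.im_ofReal_mul, Complex.conj_re, Complex.conj_im]
    field_simp
    ring

theorem re_pos_of_mem_openSector {δ : ℝ} (hδ : δ ≤ Real.pi / 2) (hz : z ∈ openSector δ) :
    0 < z.re :=
  (Complex.abs_arg_lt_pi_div_two_iff.1 (hz.2.trans_le hδ)).resolve_right hz.1

theorem arg_pos_of_im_pos (him : 0 < c.im) : 0 < c.arg :=
  (Complex.arg_nonneg_iff.2 him.le).lt_of_ne' fun h => him.ne' (Complex.arg_eq_zero_iff.1 h).2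

theorem arg_lt_pi_div_two (hre : 0 < c.re) : c.arg < Real.pi / 2 :=
  Complex.arg_lt_pi_div_two_iff.2 (.inl hre)

theorem abs_im_mul_re_lt_of_mem_openSector (hre : 0 < c.re) (hz : z ∈ openSector c.arg) :
    |z.im| * c.re < c.im * z.re := by
  have hc := arg_lt_pi_div_two hre
  have hzre : 0 < z.re := re_pos_of_mem_openSector hc.le hz
  rw [← div_lt_div_iff₀ hzre hre, ← abs_of_pos hzre, ← abs_div, ← Complex.tan_arg,
    ← Complex.tan_arg]
  have harg := abs_lt.1 hz.2
  refine abs_lt.2 ⟨?_, Real.tan_lt_tan_of_lt_of_lt_pi_div_two (by linarith) hc harg.2⟩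
  rw [← Real.tan_neg]
  exact Real.tan_lt_tan_of_lt_of_lt_pi_div_two (by linarith) (by linarith) harg.1

theorem sectorCoord_pos (hre : 0 < c.re) (him : 0 < c.im) (hz : z ∈ openSector c.arg) :
    0 < (sectorCoord c z).1 ∧ 0 < (sectorCoord c z).2 := by
  have h : |c.im⁻¹ * z.im| < c.re⁻¹ * z.re := by
    rw [abs_mul, abs_of_pos (inv_pos.2 him), inv_mul_eq_div, inv_mul_eq_div,
      div_lt_div_iff₀ him hre, mul_comm z.re]
    exact abs_im_mul_re_lt_of_mem_openSector hre hz
  obtain ⟨hneg, hpos⟩ := abs_lt.1 h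
  rw [sectorCoord_apply]
  exact ⟨by linarith, by linarith⟩

theorem norm_mul_cos_le_re {δ : ℝ} (hδ : δ ≤ Real.pi) (hz : z ∈ openSector δ) :
    ‖z‖ * Real.cos δ ≤ z.re := by
  rw [← Complex.norm_mul_cos_arg, ← Real.cos_abs z.arg]
  gcongr
  exact Real.cos_le_cos_of_nonneg_of_le_pi (abs_nonneg _) hδ hz.2.le

end SectorCoordinates

section SectorSemigroup

variable {X : Type*} [NormedAddCommGroup X] [NormedSpace ℂ X]
variable {A : X →ₗ.[ℂ] X} {S₁ S₂ : ℝ≥0 → X →L[ℂ] X} {T : ℂ → X →L[ℂ] X} {c w z : ℂ}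
variable {δ : ℝ} {x y y₁ y₂ : X}

theorem IsCommutingPair.continuous_toNNReal (h : IsCommutingPair S₁ S₂) (x : X) :
    Continuous fun p : ℝ × ℝ => S₁ p.1.toNNReal (S₂ p.2.toNNReal x) :=
  (h.continuous_apply_apply x).comp
    (continuous_real_toNNReal.prodMap continuous_real_toNNReal)

theorem IsCommutingPair.hasFDerivAt [CompleteSpace X] (h : IsCommutingPair S₁ S₂)
    (h₁ : HasDerivWithinAt (fun t : ℝ => S₁ t.toNNReal x) y₁ (Ioi 0) 0)
    (h₂ : HasDerivWithinAt (fun t : ℝ => S₂ t.toNNReal x) y₂ (Ioi 0) 0) {p : ℝ × ℝ}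
    (hp₁ : 0 < p.1) (hp₂ : 0 < p.2) :
    HasFDerivAt (fun p : ℝ × ℝ => S₁ p.1.toNNReal (S₂ p.2.toNNReal x))
      ((ContinuousLinearMap.toSpanSingleton ℝ (S₁ p.1.toNNReal (S₂ p.2.toNNReal y₁))).coprod
        (ContinuousLinearMap.toSpanSingleton ℝ (S₁ p.1.toNNReal (S₂ p.2.toNNReal y₂)))) p := by
  have hcont (y : X) : ContinuousAt (fun q : ℝ × ℝ =>
      ContinuousLinearMap.toSpanSingleton ℝ (S₁ q.1.toNNReal (S₂ q.2.toNNReal y))) p :=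
    (ContinuousLinearMap.toSpanSingletonCLE (𝕜 := ℝ) (E := X)).continuous.continuousAt.comp
      (h.continuous_toNNReal y).continuousAt
  refine (hasStrictFDerivAt_uncurry_coprod (𝕜 := ℝ) (u := p)
    (f := fun s t => S₁ s.toNNReal (S₂ t.toNNReal x))
    (f₁ := fun s t => ContinuousLinearMap.toSpanSingleton ℝ (S₁ s.toNNReal (S₂ t.toNNReal y₁)))
    (f₂ := fun s t => ContinuousLinearMap.toSpanSingleton ℝ (S₁ s.toNNReal (S₂ t.toNNReal y₂)))
    ?_ ?_ (hcont y₁) (hcont y₂)).hasFDerivAt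
  · filter_upwards [continuousAt_fst.eventually_const_lt hp₁] with q hq
    simp only [h.apply_comm]
    exact (((S₂ q.2.toNNReal).restrictScalars ℝ).hasFDerivAt.comp_hasDerivAt q.1
      (h.left.hasDerivAt h₁ hq)).hasFDerivAt
  · filter_upwards [continuousAt_snd.eventually_const_lt hp₂] with q hq
    exact (((S₁ q.1.toNNReal).restrictScalars ℝ).hasFDerivAt.comp_hasDerivAt q.2
      (h.right.hasDerivAt h₂ hq)).hasFDerivAt

/-- The semigroup `z ↦ S₁ s ∘ S₂ t` on the sector spanned by `c` and `conj c`, where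
`z = s c + t (conj c)`. Outside that sector the values are junk. If `S₁` and `S₂` are generated by
`c • A` and `conj c • A`, then it is formally `z ↦ exp (z A)`. -/
noncomputable def sectorSemigroup (c : ℂ) (S₁ S₂ : ℝ≥0 → X →L[ℂ] X) (z : ℂ) : X →L[ℂ] X :=
  (S₁ (sectorCoord c z).1.toNNReal).comp (S₂ (sectorCoord c z).2.toNNReal)

theorem sectorSemigroup_apply : sectorSemigroup c S₁ S₂ z x =
    S₁ (sectorCoord c z).1.toNNReal (S₂ (sectorCoord c z).2.toNNReal x) := rfl

namespace IsCommutingPair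

theorem sectorSemigroup_zero (h : IsCommutingPair S₁ S₂) :
    sectorSemigroup c S₁ S₂ 0 = ContinuousLinearMap.id ℂ X := by
  simp [sectorSemigroup, h.left.map_zero, h.right.map_zero]

theorem sectorSemigroup_add (h : IsCommutingPair S₁ S₂) (hre : 0 < c.re) (him : 0 < c.im)
    (hz : z ∈ openSector c.arg) (hw : w ∈ openSector c.arg) :
    sectorSemigroup c S₁ S₂ (z + w) =
      (sectorSemigroup c S₁ S₂ z).comp (sectorSemigroup c S₁ S₂ w) := by
  obtain ⟨hz₁, hz₂⟩ := sectorCoord_pos hre him hz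
  obtain ⟨hw₁, hw₂⟩ := sectorCoord_pos hre him hw
  ext x
  simp only [sectorSemigroup_apply, ContinuousLinearMap.comp_apply, map_add, Prod.fst_add,
    Prod.snd_add, Real.toNNReal_add hz₁.le hw₁.le, Real.toNNReal_add hz₂.le hw₂.le,
    h.apply_add_apply_add]

theorem continuous_sectorSemigroup (h : IsCommutingPair S₁ S₂) (x : X) :
    Continuous fun z => sectorSemigroup c S₁ S₂ z x :=
  (h.continuous_toNNReal x).comp (sectorCoord c).continuous

theorem tendsto_sectorSemigroup (h : IsCommutingPair S₁ S₂) (s : Set ℂ) (x : X) :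
    Tendsto (fun z => sectorSemigroup c S₁ S₂ z x) (𝓝[s] 0) (𝓝 x) := by
  simpa [h.sectorSemigroup_zero] using
    ((h.continuous_sectorSemigroup (c := c) x).tendsto 0).mono_left nhdsWithin_le_nhds

theorem norm_sectorSemigroup_le (h : IsCommutingPair S₁ S₂) (z : ℂ) :
    ‖sectorSemigroup c S₁ S₂ z‖ ≤ 1 :=
  h.norm_comp_le _ _

variable [CompleteSpace X]

theorem hasDerivAt_sectorSemigroup (h : IsCommutingPair S₁ S₂) (h₁ : IsGenerator (c • A) S₁)
    (h₂ : IsGenerator (conj c • A) S₂) (hre : 0 < c.re) (him : 0 < c.im)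
    (hxy : (x, y) ∈ A.graph) (hz : z ∈ openSector c.arg) :
    HasDerivAt (fun z => sectorSemigroup c S₁ S₂ z x) (sectorSemigroup c S₁ S₂ z y) z := by
  have hc : c ≠ 0 := fun hc => by simp [hc] at hre
  obtain ⟨hpos₁, hpos₂⟩ := sectorCoord_pos hre him hz
  rw [isGenerator_iff_hasDerivWithinAt h.left.map_zero] at h₁
  rw [isGenerator_iff_hasDerivWithinAt h.right.map_zero] at h₂
  have hreal := (h.hasFDerivAt ((h₁ x (c • y)).1 ((mem_graph_smul_iff hc).2 hxy))
    ((h₂ x (conj c • y)).1 ((mem_graph_smul_iff (star_ne_zero.2 hc)).2 hxy)) hpos₁ hpos₂).comp z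
    (sectorCoord c).hasFDerivAt
  have hcomplex : HasFDerivAt (fun z => sectorSemigroup c S₁ S₂ z x)
      (ContinuousLinearMap.toSpanSingleton ℂ (sectorSemigroup c S₁ S₂ z y)) z := by
    refine hasFDerivAt_of_restrictScalars ℝ hreal (ContinuousLinearMap.ext fun v => ?_)
    simp only [ContinuousLinearMap.coe_restrictScalars', ContinuousLinearMap.comp_apply,
      ContinuousLinearMap.coprod_apply, ContinuousLinearMap.toSpanSingleton_apply, map_smul,
      ← sectorSemigroup_apply, ← Complex.coe_smul, smul_smul, ← add_smul,
      sectorCoord_fst_mul_add_snd_mul_conj hre.ne' him.ne']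
  simpa using hcomplex.hasDerivAt

theorem differentiableOn_sectorSemigroup (h : IsCommutingPair S₁ S₂)
    (hA : Dense (A.domain : Set X)) (h₁ : IsGenerator (c • A) S₁)
    (h₂ : IsGenerator (conj c • A) S₂) (hre : 0 < c.re) (him : 0 < c.im) :
    DifferentiableOn ℂ (sectorSemigroup c S₁ S₂) (openSector c.arg) := by
  have hopen : IsOpen (openSector c.arg) := isOpen_openSector (Complex.arg_le_pi c)
  refine differentiableOn_of_forall_differentiableOn_apply hopen h.norm_sectorSemigroup_le
    fun x => ?_
  obtain ⟨u, hu, hux⟩ := mem_closure_iff_seq_limit.1 (hA x)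
  have hunif : TendstoUniformlyOn (fun n z => sectorSemigroup c S₁ S₂ z (u n))
      (fun z => sectorSemigroup c S₁ S₂ z x) atTop (openSector c.arg) := by
    refine Metric.tendstoUniformlyOn_iff.2 fun ε hε => ?_
    filter_upwards [Metric.tendsto_nhds.1 hux ε hε] with n hn z _
    calc dist (sectorSemigroup c S₁ S₂ z x) (sectorSemigroup c S₁ S₂ z (u n))
        = ‖sectorSemigroup c S₁ S₂ z (u n - x)‖ := by rw [dist_comm, dist_eq_norm, map_sub]
      _ ≤ 1 * ‖u n - x‖ := ContinuousLinearMap.le_of_opNorm_le _ (h.norm_sectorSemigroup_le z) _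
      _ < ε := by rwa [one_mul, ← dist_eq_norm]
  refine hunif.tendstoLocallyUniformlyOn.differentiableOn
    (Eventually.of_forall fun n z hz => ?_) hopen
  obtain ⟨y, hy⟩ := LinearPMap.mem_domain_iff.1 (hu n)
  exact (h.hasDerivAt_sectorSemigroup h₁ h₂ hre him hy hz).differentiableAt.differentiableWithinAt

theorem isAnalyticSemigroup (h : IsCommutingPair S₁ S₂) (hA : Dense (A.domain : Set X))
    (h₁ : IsGenerator (c • A) S₁) (h₂ : IsGenerator (conj c • A) S₂) (hre : 0 < c.re)
    (him : 0 < c.im) : IsAnalyticSemigroup c.arg (sectorSemigroup c S₁ S₂) where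
  map_zero := h.sectorSemigroup_zero
  map_add _ hz _ hw := h.sectorSemigroup_add hre him hz hw
  differentiableOn := h.differentiableOn_sectorSemigroup hA h₁ h₂ hre him
  tendsto_zero _ _ _ x := h.tendsto_sectorSemigroup _ x

theorem isGenerator_sectorSemigroup (h : IsCommutingPair S₁ S₂) (h₁ : IsGenerator (c • A) S₁)
    (h₂ : IsGenerator (conj c • A) S₂) (hre : 0 < c.re) (him : 0 < c.im)
    (hres : 1 ∈ resolventSet (c • A)) :
    IsGenerator A fun t : ℝ≥0 => sectorSemigroup c S₁ S₂ (t : ℝ) := by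
  have hc : c ≠ 0 := fun hc => by simp [hc] at hre
  obtain ⟨R, hR⟩ := hres
  rw [← mul_inv_cancel₀ hc, isResolvent_smul_iff hc] at hR
  have hinv : 0 < (c⁻¹).re := by
    rw [Complex.inv_re]
    exact div_pos hre (Complex.normSq_pos.2 hc)
  refine isGenerator_of_forall_mem_graph (ω := 0) (by simp [h.sectorSemigroup_zero])
    (fun t => by simpa using h.norm_sectorSemigroup_le _) (fun x y hxy => ?_) hinv hR
  have hlim (v : X) : Tendsto (fun t : ℝ => sectorSemigroup c S₁ S₂ (1 * t) v) (𝓝[>] 0) (𝓝 v) := by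
    simpa [h.sectorSemigroup_zero, Function.comp_def] using
      (((h.continuous_sectorSemigroup (c := c) v).comp
        Complex.continuous_ofReal).tendsto 0).mono_left nhdsWithin_le_nhds
  have hderiv := hasDerivWithinAt_ray h.sectorSemigroup_zero (c := 1) (fun t ht =>
    h.hasDerivAt_sectorSemigroup h₁ h₂ hre him hxy
      (mul_real_mem_openSector (one_mem_openSector (arg_pos_of_im_pos him)) ht)) (hlim x) (hlim y)
  simp only [one_mul, one_smul] at hderiv
  exact hderiv.congr (fun t ht => by rw [Real.coe_toNNReal t (le_of_lt ht)]) (by simp)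

end IsCommutingPair

theorem IsAnalyticSemigroup.exp_smul (hT : IsAnalyticSemigroup δ T) (w : ℂ) :
    IsAnalyticSemigroup δ fun z => exp (w * z) • T z where
  map_zero := by simp [hT.map_zero]
  map_add z hz z' hz' := by
    rw [hT.map_add z hz z' hz', mul_add, Complex.exp_add, ContinuousLinearMap.smul_comp,
      ContinuousLinearMap.comp_smul, smul_smul]
  differentiableOn :=
    (by fun_prop : Differentiable ℂ fun z => exp (w * z)).differentiableOn.smul
      hT.differentiableOn
  tendsto_zero δ' hδ' hlt x := by
    have hexp : Tendsto (fun z => exp (w * z)) (𝓝[openSector δ'] 0) (𝓝 1) := by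
      simpa using ((by fun_prop : Continuous fun z => exp (w * z)).tendsto 0).mono_left
        nhdsWithin_le_nhds
    simpa using hexp.smul (hT.tendsto_zero δ' hδ' hlt x)

theorem re_mul_le_of_mem_openSector (hδ : 0 ≤ δ) (hδ' : δ < Real.pi / 2) (w : ℂ)
    (hz : z ∈ openSector δ) : (w * z).re ≤ ‖w‖ / Real.cos δ * z.re := by
  have hcos : 0 < Real.cos δ := Real.cos_pos_of_mem_Ioo ⟨by linarith [Real.pi_pos], hδ'⟩
  calc (w * z).re ≤ ‖w‖ * ‖z‖ := (Complex.re_le_norm _).trans (norm_mul _ _).le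
    _ = ‖w‖ / Real.cos δ * (‖z‖ * Real.cos δ) := by field_simp
    _ ≤ ‖w‖ / Real.cos δ * z.re := by
      gcongr
      exact norm_mul_cos_le_re (by linarith [Real.pi_pos]) hz

theorem exists_generatesAnalyticContractive [CompleteSpace X] (hA : Dense (A.domain : Set X))
    (hre : 0 < c.re) (him : 0 < c.im) (h₁ : IsMDissipative (c • A) (c * w).re)
    (h₂ : IsMDissipative (conj c • A) (conj c * w).re) :
    ∃ ω, GeneratesAnalyticContractive A ω := by
  have hc : c ≠ 0 := fun hc => by simp [hc] at hre
  have hshift {a : ℂ} (h : IsMDissipative (a • A) (a * w).re) :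
      IsMDissipative (a • shift w A) 0 := by
    rw [smul_shift]
    simpa using h.shift (a * w)
  obtain ⟨S₁, S₂, hS, hgen₁, hgen₂⟩ := exists_isCommutingPair (A := shift w A) hA hc
    (star_ne_zero.2 hc) (hshift h₁) (hshift h₂)
  have harg := arg_pos_of_im_pos him
  have harg' := arg_lt_pi_div_two hre
  have hT := hS.isAnalyticSemigroup (A := shift w A) hA hgen₁ hgen₂ hre him
  have hgen := (hS.isGenerator_sectorSemigroup hgen₁ hgen₂ hre him
    ((hshift h₁).mem_resolventSet 1 (by simp))).expScale (by simp [hT.map_zero]) (-w)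
  rw [shift_neg_shift] at hgen
  refine ⟨‖w‖ / Real.cos c.arg, c.arg, harg, harg'.le, _, hT.exp_smul w, ?_, fun z hz => ?_⟩
  · convert hgen using 2 with t
    simp [expScale]
  · calc ‖exp (w * z) • sectorSemigroup c S₁ S₂ z‖ ≤ Real.exp (w * z).re * 1 := by
          rw [norm_smul, Complex.norm_exp]
          gcongr
          exact hS.norm_sectorSemigroup_le z
      _ ≤ Real.exp (‖w‖ / Real.cos c.arg * z.re) := by
          rw [mul_one, Real.exp_le_exp]
          exact re_mul_le_of_mem_openSector harg.le harg' w hz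

end SectorSemigroup

section BoundedOperators

variable {X : Type*} [NormedAddCommGroup X] [NormedSpace ℂ X]
variable {A : X →ₗ.[ℂ] X} {B : X →L[ℂ] X} {x y : X} {μ : ℂ} {r : ℝ}

/-- A bounded operator, viewed as a partially defined operator with domain `X`. -/
noncomputable def ofCLM (B : X →L[ℂ] X) : X →ₗ.[ℂ] X :=
  (B : X →ₗ[ℂ] X).toPMap ⊤

theorem mem_graph_ofCLM_iff : (x, y) ∈ (ofCLM B).graph ↔ y = B x := by
  rw [LinearPMap.mem_graph_iff]
  refine ⟨?_, fun h => ⟨⟨x, Submodule.mem_top⟩, rfl, h.symm⟩⟩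
  rintro ⟨z, rfl, rfl⟩
  rfl

theorem eq_ofCLM_of_forall_mem_graph (h : ∀ x, (x, B x) ∈ A.graph) : A = ofCLM B := by
  refine LinearPMap.eq_of_eq_graph (SetLike.ext ?_)
  rintro ⟨x, y⟩
  rw [mem_graph_ofCLM_iff]
  exact ⟨fun hxy => LinearPMap.mem_graph_snd_inj A hxy (h x) rfl, fun hy => hy ▸ h x⟩

theorem smul_ofCLM (c : ℂ) (B : X →L[ℂ] X) : c • ofCLM B = ofCLM (c • B) :=
  LinearPMap.ext rfl fun _ _ _ => rfl

theorem IsResolvent.eq_ofCLM {u : (X →L[ℂ] X)ˣ} (h : IsResolvent A μ u) :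
    A = ofCLM (μ • 1 - (↑u⁻¹ : X →L[ℂ] X)) := by
  refine eq_ofCLM_of_forall_mem_graph fun x => ?_
  have hx : (u : X →L[ℂ] X) ((↑u⁻¹ : X →L[ℂ] X) x) = x := DFunLike.congr_fun u.mul_inv x
  have hmem := h.apply_mem_graph ((↑u⁻¹ : X →L[ℂ] X) x)
  rwa [hx] at hmem

theorem isResolvent_ofCLM {u : (X →L[ℂ] X)ˣ} (hu : (u : X →L[ℂ] X) = μ • 1 - B) :
    IsResolvent (ofCLM B) μ ↑u⁻¹ := by
  refine isResolvent_iff_graph.2 ⟨fun x => ?_, fun x y hxy => ?_⟩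
  · have h : (u : X →L[ℂ] X) ((↑u⁻¹ : X →L[ℂ] X) x) = x := DFunLike.congr_fun u.mul_inv x
    rw [hu] at h
    exact mem_graph_ofCLM_iff.2 (sub_eq_of_eq_add' (sub_eq_iff_eq_add.1 h))
  · have h : (↑u⁻¹ : X →L[ℂ] X) ((u : X →L[ℂ] X) x) = x := DFunLike.congr_fun u.inv_mul x
    rwa [hu, show (μ • (1 : X →L[ℂ] X) - B) x = μ • x - B x from rfl,
      ← mem_graph_ofCLM_iff.1 hxy] at h

theorem isMDissipative_ofCLM [CompleteSpace X] (B : X →L[ℂ] X) :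
    IsMDissipative (ofCLM B) ‖B‖ where
  re_le := by
    rintro _ ⟨x, y, hxy, hx, f, hf, -, rfl⟩
    rw [mem_graph_ofCLM_iff.1 hxy]
    calc (f (B x)).re ≤ ‖f (B x)‖ := Complex.re_le_norm _
      _ ≤ 1 * ‖B x‖ := f.le_of_opNorm_le hf _
      _ ≤ ‖B‖ := by simpa [hx] using B.le_opNorm x
  mem_resolventSet := fun μ hμ => by
    have hμB : ‖B‖ * ‖(1 : X →L[ℂ] X)‖ < ‖μ‖ :=
      (mul_le_of_le_one_right (norm_nonneg B) ContinuousLinearMap.norm_id_le).trans_lt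
        (hμ.trans_le (Complex.re_le_norm μ))
    obtain ⟨u, hu⟩ := spectrum.mem_resolventSet_iff.1 (spectrum.mem_resolventSet_of_norm_lt_mul hμB)
    exact ⟨_, isResolvent_ofCLM (hu.trans (by rw [Algebra.algebraMap_eq_smul_one]))⟩

theorem isMDissipative_rot_ofCLM [CompleteSpace X] (B : X →L[ℂ] X) (θ : ℝ) :
    IsMDissipative (rot θ (ofCLM B)) ‖B‖ := by
  rw [rot, smul_ofCLM]
  simpa only [norm_smul, norm_exp_neg_I_mul, one_mul]
    using isMDissipative_ofCLM (exp (-(I * θ)) • B)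

theorem exp_neg_I_mul_arg_mul (w : ℂ) : exp (-(I * w.arg)) * w = ‖w‖ := by
  nth_rw 2 [← Complex.norm_mul_exp_arg_mul_I w]
  rw [mul_left_comm, ← Complex.exp_add, mul_comm I, neg_add_cancel, Complex.exp_zero, mul_one]

theorem mem_closedBall_iff_forall_notMem_halfPlane {w : ℂ} :
    w ∈ Metric.closedBall 0 r ↔ ∀ θ, w ∈ (halfPlane θ r)ᶜ := by
  simp only [mem_closedBall_zero_iff, mem_compl_iff, mem_halfPlane, not_lt]
  refine ⟨fun hw θ => (Complex.re_le_norm _).trans ?_, fun hw => ?_⟩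
  · rwa [norm_mul, norm_exp_neg_I_mul, one_mul]
  · simpa only [exp_neg_I_mul_arg_mul, Complex.ofReal_re] using hw w.arg

theorem numericalSpectrum_subset_closedBall_iff (hA : Dense (A.domain : Set X)) :
    numericalSpectrum A ⊆ Metric.closedBall 0 r ↔ ∀ θ, IsMDissipative (rot θ A) r := by
  simp only [← numericalSpectrum_subset_compl_halfPlane_iff hA, subset_def,
    mem_closedBall_iff_forall_notMem_halfPlane]
  exact ⟨fun h θ w hw => h w hw θ, fun h w hw θ => h θ w hw⟩

theorem exists_isResolvent_norm_le_of_norm_lt (hA : Dense (A.domain : Set X))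
    (h : ∀ θ, IsMDissipative (rot θ A) r) (hμ : r < ‖μ‖) :
    ∃ R, IsResolvent A μ R ∧ ‖R‖ ≤ 1 / (‖μ‖ - r) := by
  rw [← exists_isResolvent_rot_norm_le_iff (θ := μ.arg), exp_neg_I_mul_arg_mul]
  simpa using (isMDissipative_iff_norm_resolvent_le (A := rot μ.arg A) hA).1 (h μ.arg) ‖μ‖
    (by simpa using hμ)

variable {R : ℂ → X →L[ℂ] X}

/-- The resolvent is holomorphic at `∞` with value `0`, and its derivative there is the limit of
`μ R(μ)`. -/
theorem exists_tendsto_smul_resolvent_cobounded [CompleteSpace X]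
    (hR : ∀ᶠ μ in Bornology.cobounded ℂ, IsResolvent A μ (R μ))
    (hR0 : Tendsto R (Bornology.cobounded ℂ) (𝓝 0)) :
    ∃ L, Tendsto (fun μ => μ • R μ) (Bornology.cobounded ℂ) (𝓝 L) := by
  have hne : ∀ᶠ z : ℂ in 𝓝[≠] 0, z ≠ 0 := self_mem_nhdsWithin
  have hdiff : ∀ᶠ z in 𝓝[≠] 0, DifferentiableAt ℂ (Function.update (fun z => R z⁻¹) 0 0) z := by
    obtain ⟨r, -, hr⟩ := (Metric.hasBasis_cobounded_compl_closedBall (0 : ℂ)).eventually_iff.1 hR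
    simp only [mem_compl_iff, mem_closedBall_zero_iff, not_le] at hr
    filter_upwards [hne, tendsto_inv₀_nhdsNE_zero.eventually
      (tendsto_norm_cobounded_atTop.eventually_gt_atTop r)] with z hz hzr
    have hres : DifferentiableAt ℂ R z⁻¹ := differentiableAt_of_isResolvent
      ((isOpen_lt continuous_const continuous_norm).mem_nhds hzr) fun μ hμ => hr hμ
    refine (hres.comp z (differentiableAt_inv hz)).congr_of_eventuallyEq ?_
    filter_upwards [isOpen_ne.mem_nhds hz] with v hv using Function.update_of_ne hv _ _
  have hcont : ContinuousAt (Function.update (fun z => R z⁻¹) 0 0) 0 :=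
    continuousAt_update_same.2 (hR0.comp tendsto_inv₀_nhdsNE_zero)
  have hderiv := (Complex.analyticAt_of_differentiable_on_punctured_nhds_of_continuousAt
    hdiff hcont).differentiableAt.hasDerivAt.tendsto_slope_zero.comp tendsto_inv₀_cobounded'
  refine ⟨_, hderiv.congr' ?_⟩
  filter_upwards [Bornology.eventually_ne_cobounded 0] with μ hμ
  rw [Function.comp_apply, zero_add, Function.update_self, Function.update_of_ne (inv_ne_zero hμ),
    inv_inv, sub_zero]

theorem tendsto_smul_resolvent_cobounded [CompleteSpace X] (hA : Dense (A.domain : Set X))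
    (hR : ∀ᶠ μ in Bornology.cobounded ℂ, IsResolvent A μ (R μ))
    (hR0 : Tendsto R (Bornology.cobounded ℂ) (𝓝 0)) :
    Tendsto (fun μ => μ • R μ) (Bornology.cobounded ℂ) (𝓝 1) := by
  obtain ⟨L, hL⟩ := exists_tendsto_smul_resolvent_cobounded hR hR0
  have hbound : ∀ᶠ μ in Bornology.cobounded ℂ, ‖μ • R μ‖ ≤ ‖L‖ + 1 :=
    hL.norm.eventually_le_const (lt_add_one _)
  have hL1 : L = 1 := by
    ext x
    exact tendsto_nhds_unique (((ContinuousLinearMap.apply ℂ X x).continuous.tendsto L).comp hL)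
      (tendsto_smul_resolvent_apply hA tendsto_id hR hbound x)
  exact hL1 ▸ hL

/-- Once `μ R(μ)` is close to `1`, the resolvent is boundedly invertible. -/
theorem exists_eq_ofCLM [CompleteSpace X] (hA : Dense (A.domain : Set X))
    (h : ∀ θ, IsMDissipative (rot θ A) r) : ∃ B, A = ofCLM B := by
  choose! R hR using fun μ (hμ : r < ‖μ‖) => exists_isResolvent_norm_le_of_norm_lt hA h hμ
  have hlarge : ∀ᶠ μ : ℂ in Bornology.cobounded ℂ, r < ‖μ‖ :=
    tendsto_norm_cobounded_atTop.eventually_gt_atTop r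
  have hRes : ∀ᶠ μ in Bornology.cobounded ℂ, IsResolvent A μ (R μ) :=
    hlarge.mono fun μ hμ => (hR μ hμ).1
  have hzero : Tendsto (fun μ : ℂ => 1 / (‖μ‖ - r)) (Bornology.cobounded ℂ) (𝓝 0) :=
    (tendsto_atTop_add_const_right _ (-r) tendsto_norm_cobounded_atTop).const_div_atTop 1
  have hlim := tendsto_smul_resolvent_cobounded hA hRes
    (squeeze_zero_norm' (hlarge.mono fun μ hμ => (hR μ hμ).2) hzero)
  obtain ⟨μ, hunit, hμ, hμ0⟩ := ((hlim.eventually (Units.isOpen.mem_nhds isUnit_one)).and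
    (hRes.and (Bornology.eventually_ne_cobounded 0))).exists
  obtain ⟨u, hu⟩ : IsUnit (R μ) := by
    have := hunit.smul (Units.mk0 μ hμ0)⁻¹
    rwa [← Units.smul_mk0 hμ0, inv_smul_smul] at this
  exact ⟨_, (hu ▸ hμ).eq_ofCLM⟩

end BoundedOperators

section NormContinuousSemigroups

variable {X : Type*} [NormedAddCommGroup X] [NormedSpace ℂ X]
variable {A : X →ₗ.[ℂ] X} {B : X →L[ℂ] X} {T : ℝ≥0 → X →L[ℂ] X}

theorem IsGenerator.eq_ofCLM (hA : IsGenerator A T) (hT : T 0 = ContinuousLinearMap.id ℂ X)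
    (hB : HasDerivWithinAt (fun t : ℝ => T t.toNNReal) B (Ioi 0) 0) : A = ofCLM B :=
  eq_ofCLM_of_forall_mem_graph fun x => ((isGenerator_iff_hasDerivWithinAt hT).1 hA _ _).2
    (((ContinuousLinearMap.apply ℂ X x).restrictScalars ℝ).hasFDerivAt.comp_hasDerivWithinAt 0 hB)

theorem isGenerator_ofCLM (hT : T 0 = ContinuousLinearMap.id ℂ X)
    (hB : HasDerivWithinAt (fun t : ℝ => T t.toNNReal) B (Ioi 0) 0) : IsGenerator (ofCLM B) T := by
  refine (isGenerator_iff_hasDerivWithinAt hT).2 fun x y => mem_graph_ofCLM_iff.trans ?_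
  have hBx : HasDerivWithinAt (fun t : ℝ => T t.toNNReal x) (B x) (Ioi 0) 0 :=
    ((ContinuousLinearMap.apply ℂ X x).restrictScalars ℝ).hasFDerivAt.comp_hasDerivWithinAt 0 hB
  exact ⟨fun h => h ▸ hBx, fun h => (uniqueDiffWithinAt_Ioi (0 : ℝ)).eq_deriv _ h hBx⟩

theorem isCompact_numericalSpectrum_iff_exists_subset (hA : Dense (A.domain : Set X)) :
    IsCompact (numericalSpectrum A) ↔ ∃ K, IsCompact K ∧ numericalSpectrum A ⊆ K :=
  ⟨fun h => ⟨_, h, Subset.rfl⟩, fun ⟨_, hK, hAK⟩ =>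
    hK.of_isClosed_subset (isClosed_numericalSpectrum hA) hAK⟩

variable [CompleteSpace X]

theorem IsC0Semigroup.mul_integral (hT : IsC0Semigroup T) (hc : Continuous T) {h t : ℝ}
    (hh : 0 ≤ h) (ht : 0 ≤ t) :
    T h.toNNReal * ∫ s in (0 : ℝ)..t, T s.toNNReal =
      (∫ s in (0 : ℝ)..(t + h), T s.toNNReal) - ∫ s in (0 : ℝ)..h, T s.toNNReal := by
  have hint : ∀ a b, IntervalIntegrable (fun s : ℝ => T s.toNNReal) MeasureTheory.volume a b :=
    (hc.comp continuous_real_toNNReal).intervalIntegrable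
  calc T h.toNNReal * ∫ s in (0 : ℝ)..t, T s.toNNReal
      = ∫ s in (0 : ℝ)..t, T h.toNNReal * T s.toNNReal :=
        ((ContinuousLinearMap.mul ℝ (X →L[ℂ] X) (T h.toNNReal)).intervalIntegral_comp_comm
          (hint 0 t)).symm
    _ = ∫ s in (0 : ℝ)..t, T (s + h).toNNReal := by
        refine intervalIntegral.integral_congr fun s hs => ?_
        rw [uIcc_of_le ht] at hs
        rw [Real.toNNReal_add hs.1 hh, add_comm, hT.map_add]
        rfl
    _ = ∫ s in h..(t + h), T s.toNNReal := by
        rw [intervalIntegral.integral_comp_add_right (fun s => T s.toNNReal), zero_add]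
    _ = _ := (intervalIntegral.integral_interval_sub_left (hint _ _) (hint _ _)).symm

theorem hasDerivAt_integral_toNNReal (hc : Continuous T) (t : ℝ) :
    HasDerivAt (fun t => ∫ s in (0 : ℝ)..t, T s.toNNReal) (T t.toNNReal) t :=
  ((hc.comp continuous_real_toNNReal).integral_hasStrictDerivAt 0 t).hasDerivAt

/-- The averages of `T` over `[0, t]` tend to `1` as `t ↓ 0`. -/
theorem exists_isUnit_integral (hT : T 0 = ContinuousLinearMap.id ℂ X) (hc : Continuous T) :
    ∃ t : ℝ, 0 < t ∧ IsUnit (∫ s in (0 : ℝ)..t, T s.toNNReal) := by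
  have hmean := (hasDerivAt_integral_toNNReal hc 0).tendsto_slope_zero_right
  rw [Real.toNNReal_zero, hT] at hmean
  have hunits : {S : X →L[ℂ] X | IsUnit S} ∈ 𝓝 (ContinuousLinearMap.id ℂ X) :=
    Units.isOpen.mem_nhds isUnit_one
  obtain ⟨t, hunit, ht⟩ := ((hmean.eventually hunits).and self_mem_nhdsWithin).exists
  refine ⟨t, ht, ?_⟩
  have hscaled := hunit.smul (Units.mk0 t (ne_of_gt ht))
  simpa [Units.smul_mk0, smul_inv_smul₀ (ne_of_gt ht)] using hscaled

/-- With `V t = ∫₀ᵗ T` invertible, `T h = (V (t + h) - V h) (V t)⁻¹` is differentiable in `h`. -/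
theorem IsC0Semigroup.exists_hasDerivWithinAt (hT : IsC0Semigroup T) (hc : Continuous T) :
    ∃ B, HasDerivWithinAt (fun t : ℝ => T t.toNNReal) B (Ioi 0) 0 := by
  obtain ⟨t, ht, u, hu⟩ := exists_isUnit_integral hT.map_zero hc
  have hfactor : ∀ h : ℝ, 0 ≤ h → T h.toNNReal = ((∫ s in (0 : ℝ)..(t + h), T s.toNNReal) -
      ∫ s in (0 : ℝ)..h, T s.toNNReal) * (↑u⁻¹ : X →L[ℂ] X) := fun h hh => by
    rw [← hT.mul_integral hc hh ht.le, ← hu, mul_assoc, u.mul_inv, mul_one]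
  have hshift := (hasDerivAt_integral_toNNReal hc (t + 0)).comp_const_add t 0
  exact ⟨_, (((hshift.sub (hasDerivAt_integral_toNNReal hc 0)).mul_const
    (↑u⁻¹ : X →L[ℂ] X)).hasDerivWithinAt).congr (fun h hh => hfactor h (le_of_lt hh))
      (hfactor 0 le_rfl)⟩

theorem generatesNormContinuous_ofCLM (B : X →L[ℂ] X) : GeneratesNormContinuous (ofCLM B) := by
  have hderiv := hasDerivAt_exp_smul_const (𝕂 := ℝ) B
  have hcont : Continuous fun t : ℝ≥0 => NormedSpace.exp ((t : ℝ) • B) :=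
    (continuous_iff_continuousAt.2 fun t => (hderiv t).continuousAt).comp NNReal.continuous_coe
  have hzero : NormedSpace.exp (((0 : ℝ≥0) : ℝ) • B) = ContinuousLinearMap.id ℂ X := by
    rw [NNReal.coe_zero, zero_smul, NormedSpace.exp_zero]
    rfl
  refine ⟨fun t => NormedSpace.exp ((t : ℝ) • B), ⟨hzero, fun s t => ?_, fun x => ?_⟩,
    isGenerator_ofCLM hzero ?_, hcont⟩
  · simp only [NNReal.coe_add, add_smul]
    exact exp_add_of_commute (((Commute.refl B).smul_left _).smul_right _)
  · exact hcont.clm_apply continuous_const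
  · have h0 := (hderiv 0).hasDerivWithinAt (s := Ioi 0)
    rw [zero_smul, NormedSpace.exp_zero, one_mul] at h0
    exact h0.congr (fun t ht => by rw [Real.coe_toNNReal t (le_of_lt ht)]) (by simp)

theorem generatesNormContinuous_iff_exists_eq_ofCLM :
    GeneratesNormContinuous A ↔ ∃ B, A = ofCLM B := by
  constructor
  · rintro ⟨T, hT, hgen, hc⟩
    obtain ⟨B, hB⟩ := hT.exists_hasDerivWithinAt hc
    exact ⟨B, hgen.eq_ofCLM hT.map_zero hB⟩
  · rintro ⟨B, rfl⟩
    exact generatesNormContinuous_ofCLM B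

theorem exists_isCompact_iff_generatesNormContinuous (hA : Dense (A.domain : Set X)) :
    (∃ K, IsCompact K ∧ numericalSpectrum A ⊆ K) ↔ GeneratesNormContinuous A := by
  rw [generatesNormContinuous_iff_exists_eq_ofCLM]
  constructor
  · rintro ⟨K, hK, hAK⟩
    obtain ⟨r, hr⟩ := hK.isBounded.subset_closedBall 0
    exact exists_eq_ofCLM hA ((numericalSpectrum_subset_closedBall_iff hA).1 (hAK.trans hr))
  · rintro ⟨B, rfl⟩
    exact ⟨_, isCompact_closedBall 0 ‖B‖,
      (numericalSpectrum_subset_closedBall_iff hA).2 (isMDissipative_rot_ofCLM B)⟩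

end NormContinuousSemigroups

section Sectors

variable {α θ ω₁ ω₂ : ℝ} {z w : ℂ}

theorem exp_neg_I_mul_re (φ : ℝ) : (exp (-(I * φ))).re = Real.cos φ := by
  simp [Complex.exp_re]

theorem exp_neg_I_mul_im (φ : ℝ) : (exp (-(I * φ))).im = -Real.sin φ := by
  simp [Complex.exp_im]

theorem exp_neg_I_mul_add_mul (θ φ : ℝ) (z : ℂ) :
    exp (-(I * (θ + φ : ℝ))) * z = exp (-(I * θ)) * (exp (-(I * φ)) * z) := by
  rw [← mul_assoc, ← Complex.exp_add, Complex.ofReal_add, mul_add, neg_add]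

theorem exp_neg_I_mul_pi_add_mul (θ : ℝ) (z : ℂ) :
    exp (-(I * (Real.pi + θ : ℝ))) * z = -(exp (-(I * θ)) * z) := by
  rw [exp_neg_I_mul_add_mul, mul_comm I, Complex.exp_neg (Real.pi * I), Complex.exp_pi_mul_I,
    inv_neg_one, neg_one_mul]

theorem re_exp_neg_I_mul_mul (φ : ℝ) (v : ℂ) :
    (exp (-(I * φ)) * v).re = ‖v‖ * Real.cos (v.arg - φ) := by
  rw [Complex.mul_re, exp_neg_I_mul_re, exp_neg_I_mul_im, Real.cos_sub]
  linear_combination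
    -Real.cos φ * Complex.norm_mul_cos_arg v - Real.sin φ * Complex.norm_mul_sin_arg v

theorem abs_arg_le_iff (hα : α ∈ Ioo 0 (Real.pi / 2)) :
    |w.arg| ≤ Real.pi / 2 - α ↔
      0 ≤ (exp (-(I * α)) * w).re ∧ 0 ≤ (exp (-(I * (-α : ℝ))) * w).re := by
  obtain ⟨hα₀, hα₁⟩ := hα
  rcases eq_or_ne w 0 with rfl | hw
  · simpa using hα₁.le
  simp only [re_exp_neg_I_mul_mul, mul_nonneg_iff_of_pos_left (norm_pos_iff.2 hw), abs_le]
  refine ⟨fun h => ⟨Real.cos_nonneg_of_mem_Icc ⟨?_, ?_⟩, Real.cos_nonneg_of_mem_Icc ⟨?_, ?_⟩⟩,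
    fun h => ⟨?_, ?_⟩⟩
  iterate 4 linarith
  · by_contra! hlt
    have := Real.cos_neg_of_pi_div_two_lt_of_lt (x := -(w.arg - α)) (by linarith)
      (by linarith [w.neg_pi_lt_arg])
    exact h.1.not_gt (by rwa [Real.cos_neg] at this)
  · by_contra! hlt
    exact h.2.not_gt (Real.cos_neg_of_pi_div_two_lt_of_lt (by linarith)
      (by linarith [w.arg_le_pi]))

theorem sector_eq_inter (hα : α ∈ Ioo 0 (Real.pi / 2)) :
    sector θ (Real.pi / 2 - α) z =
      (halfPlane (α + (Real.pi - θ)) (exp (-(I * (α + (Real.pi - θ) : ℝ))) * z).re)ᶜ ∩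
        (halfPlane (-α + (Real.pi - θ)) (exp (-(I * (-α + (Real.pi - θ) : ℝ))) * z).re)ᶜ := by
  have hrot : ∀ (φ : ℝ) (v : ℂ), exp (-(I * (φ + (Real.pi - θ) : ℝ))) * v =
      -(exp (-(I * φ)) * (exp (I * θ) * v)) := fun φ v => by
    rw [show φ + (Real.pi - θ) = Real.pi + (φ + -θ) by ring, exp_neg_I_mul_pi_add_mul,
      exp_neg_I_mul_add_mul, Complex.ofReal_neg, mul_neg, neg_neg]
  ext w
  simp only [sector, mem_ofPred_eq, abs_arg_le_iff hα, mem_inter_iff, mem_compl_iff,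
    mem_halfPlane, not_lt, hrot, mul_sub, Complex.sub_re, Complex.neg_re, neg_le_neg_iff,
    sub_nonneg]

theorem exists_re_exp_mul_eq (hα : α ∈ Ioo 0 (Real.pi / 2)) (ω₁ ω₂ : ℝ) :
    ∃ z : ℂ, (exp (-(I * α)) * z).re = ω₁ ∧ (exp (-(I * (-α : ℝ))) * z).re = ω₂ := by
  have hs : Real.sin α ≠ 0 :=
    (Real.sin_pos_of_pos_of_lt_pi hα.1 (by linarith [hα.2, Real.pi_pos])).ne'
  have hc : Real.cos α ≠ 0 :=
    (Real.cos_pos_of_mem_Ioo ⟨by linarith [hα.1, Real.pi_pos], hα.2⟩).ne'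
  refine ⟨⟨(ω₁ + ω₂) / (2 * Real.cos α), (ω₁ - ω₂) / (2 * Real.sin α)⟩, ?_, ?_⟩ <;>
  · simp only [Complex.mul_re, exp_neg_I_mul_re, exp_neg_I_mul_im, Real.cos_neg, Real.sin_neg]
    field_simp
    ring

theorem strip_eq_inter (θ ω₁ ω₂ : ℝ) :
    strip θ ω₁ ω₂ = (halfPlane (-θ) ω₂)ᶜ ∩ (halfPlane (Real.pi + -θ) (-ω₁))ᶜ := by
  ext w
  simp only [strip, mem_ofPred_eq, mem_inter_iff, mem_compl_iff, mem_halfPlane, not_lt,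
    exp_neg_I_mul_pi_add_mul, Complex.neg_re, neg_le_neg_iff, Complex.ofReal_neg, mul_neg,
    neg_neg, and_comm]

theorem setOf_re_exp_mul_eq_zero (θ : ℝ) :
    {w : ℂ | (exp (-(I * θ)) * w).re = 0} = (halfPlane θ 0)ᶜ ∩ (halfPlane (Real.pi + θ) 0)ᶜ := by
  ext w
  simp only [mem_ofPred_eq, mem_inter_iff, mem_compl_iff, mem_halfPlane, not_lt,
    exp_neg_I_mul_pi_add_mul, Complex.neg_re, Left.neg_nonpos_iff, le_antisymm_iff]

theorem nonempty_halfPlane (θ ω : ℝ) : (halfPlane θ ω).Nonempty := by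
  obtain ⟨w, hw⟩ := mul_left_surjective₀ (Complex.exp_ne_zero (-(I * θ))) ((ω + 1 : ℝ) : ℂ)
  exact ⟨w, by simp [mem_halfPlane, show _ = _ from hw]⟩

theorem exp_neg_I_mul_mem_openSector {α δ : ℝ} (hα : |α| < δ) (hδ : δ ≤ Real.pi / 2) :
    exp (-(I * α)) ∈ openSector δ := by
  refine ⟨Complex.exp_ne_zero _, ?_⟩
  have hlt := abs_lt.1 (hα.trans_le hδ)
  have harg : (exp (-(I * α))).arg = -α := by
    rw [show -(I * α) = (-α : ℝ) * I by push_cast; ring, Complex.exp_mul_I]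
    exact Complex.arg_cos_add_sin_mul_I ⟨by linarith [Real.pi_pos], by linarith [Real.pi_pos]⟩
  rwa [harg, abs_neg]

end Sectors

section Classification

variable {X : Type*} [NormedAddCommGroup X] [NormedSpace ℂ X]
variable {A : X →ₗ.[ℂ] X} {α θ d ω₁ ω₂ : ℝ} {z : ℂ}

theorem numericalSpectrum_subset_sector_iff (hA : Dense (A.domain : Set X))
    (hα : α ∈ Ioo 0 (Real.pi / 2)) :
    numericalSpectrum A ⊆ sector θ (Real.pi / 2 - α) z ↔
      IsMDissipative (rot α (rot (Real.pi - θ) A))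
        (exp (-(I * α)) * (exp (-(I * (Real.pi - θ : ℝ))) * z)).re ∧
      IsMDissipative (rot (-α) (rot (Real.pi - θ) A))
        (exp (-(I * (-α : ℝ))) * (exp (-(I * (Real.pi - θ : ℝ))) * z)).re := by
  simp only [sector_eq_inter hα, subset_inter_iff, rot_rot, ← exp_neg_I_mul_add_mul,
    numericalSpectrum_subset_compl_halfPlane_iff hA]

theorem exists_numericalSpectrum_subset_sector (hA : Dense (A.domain : Set X)) (hd₀ : 0 < d)
    (hd₁ : d < Real.pi) (h₁ : IsMDissipative (rot θ A) ω₁)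
    (h₂ : IsMDissipative (rot (θ + d) A) ω₂) :
    ∃ θ, ∃ δ ∈ Ioo (0 : ℝ) (Real.pi / 2), ∃ z : ℂ, numericalSpectrum A ⊆ sector θ δ z := by
  have hd : d / 2 ∈ Ioo 0 (Real.pi / 2) := ⟨by linarith, by linarith⟩
  obtain ⟨v, hv₂, hv₁⟩ := exists_re_exp_mul_eq hd ω₂ ω₁
  obtain ⟨z, hz : _ * z = v⟩ :=
    mul_left_surjective₀ (Complex.exp_ne_zero (-(I * (θ + d / 2 : ℝ)))) v
  refine ⟨Real.pi - (θ + d / 2), Real.pi / 2 - d / 2, ⟨by linarith, by linarith⟩, z, ?_⟩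
  rw [numericalSpectrum_subset_sector_iff hA hd, sub_sub_cancel, hz, hv₁, hv₂, rot_rot, rot_rot,
    show d / 2 + (θ + d / 2) = θ + d by ring, show -(d / 2) + (θ + d / 2) = θ by ring]
  exact ⟨h₂, h₁⟩

theorem exists_numericalSpectrum_subset_strip (hA : Dense (A.domain : Set X))
    (h₁ : IsMDissipative (rot θ A) ω₁) (h₂ : IsMDissipative (rot (Real.pi + θ) A) ω₂) :
    ∃ θ, ∃ ω₁ ω₂ : ℝ, ω₁ < ω₂ ∧ numericalSpectrum A ⊆ strip θ ω₁ ω₂ := by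
  have hlt : -ω₂ < max ω₁ (-ω₂ + 1) := (lt_add_one _).trans_le (le_max_right _ _)
  refine ⟨-θ, -ω₂, _, hlt, ?_⟩
  rw [strip_eq_inter, neg_neg, neg_neg, subset_inter_iff,
    numericalSpectrum_subset_compl_halfPlane_iff hA,
    numericalSpectrum_subset_compl_halfPlane_iff hA]
  exact ⟨h₁.mono (le_max_left _ _), h₂⟩

theorem exists_subset_sector_or_exists_subset_strip (hA : Dense (A.domain : Set X))
    {θ₁ θ₂ : ℝ} (hlt : θ₁ < θ₂) (hlt' : θ₂ < θ₁ + 2 * Real.pi)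
    (h₁ : IsMDissipative (rot θ₁ A) ω₁) (h₂ : IsMDissipative (rot θ₂ A) ω₂) :
    (∃ θ, ∃ δ ∈ Ioo (0 : ℝ) (Real.pi / 2), ∃ z : ℂ, numericalSpectrum A ⊆ sector θ δ z) ∨
      ∃ θ, ∃ ω₁ ω₂ : ℝ, ω₁ < ω₂ ∧ numericalSpectrum A ⊆ strip θ ω₁ ω₂ := by
  rcases lt_trichotomy (θ₂ - θ₁) Real.pi with hπ | hπ | hπ
  · exact .inl (exists_numericalSpectrum_subset_sector hA (sub_pos.2 hlt) hπ h₁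
      (by rwa [add_sub_cancel]))
  · exact .inr (exists_numericalSpectrum_subset_strip hA h₁ (by rwa [← hπ, sub_add_cancel]))
  · have h₁' : IsMDissipative (rot (θ₂ + (θ₁ + 2 * Real.pi - θ₂)) A) ω₁ := by
      rwa [show θ₂ + (θ₁ + 2 * Real.pi - θ₂) = Real.pi + (Real.pi + θ₁) by ring, rot_pi_add,
        rot_pi_add, neg_neg]
    exact .inl (exists_numericalSpectrum_subset_sector hA (by linarith) (by linarith) h₂ h₁')

theorem numericalSpectrum_eq_univ_iff (hA : Dense (A.domain : Set X)) :
    numericalSpectrum A = univ ↔ ¬ ∃ θ ω, IsMDissipative (rot θ A) ω := by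
  simp only [numericalSpectrum, compl_univ_iff, eq_empty_iff_forall_notMem,
    mem_numericalResolventSet_iff hA]
  refine ⟨fun h ⟨θ, ω, hdiss⟩ => ?_, fun h w ⟨θ, ω, _, hdiss⟩ => h ⟨θ, ω, hdiss⟩⟩
  obtain ⟨w, hw⟩ := nonempty_halfPlane θ ω
  exact h w ⟨θ, ω, hw, hdiss⟩

theorem eq_compl_halfPlane_or_eq_empty_of_forall_eq (hA : Dense (A.domain : Set X)) {ω₀ : ℝ}
    (h₀ : IsMDissipative (rot θ A) ω₀)
    (huniq : ∀ φ ∈ Ico (0 : ℝ) (2 * Real.pi), ∀ ω, IsMDissipative (rot φ A) ω → φ = θ) :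
    (∃ ω, numericalSpectrum A = (halfPlane θ ω)ᶜ) ∨ numericalSpectrum A = ∅ := by
  set S : Set ℝ := {ω | IsMDissipative (rot θ A) ω}
  have hmem : ∀ w, w ∈ numericalResolventSet A ↔ ∃ ω ∈ S, w ∈ halfPlane θ ω := by
    refine fun w => ⟨?_, fun ⟨ω, h, hw⟩ => (mem_numericalResolventSet_iff hA).2 ⟨θ, ω, hw, h⟩⟩
    rintro ⟨φ, hφ, ω, hw, h⟩
    have h := (isMDissipative_rot_iff hA).2 h
    obtain rfl := huniq φ hφ ω h
    exact ⟨ω, h, hw⟩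
  by_cases hb : BddBelow S
  · refine .inl ⟨sInf S, congrArg _ (ext fun w => ?_)⟩
    rw [hmem, mem_halfPlane, csInf_lt_iff hb ⟨ω₀, h₀⟩]
    rfl
  · exact .inr (compl_empty_iff.2 (eq_univ_of_forall fun w =>
      (hmem w).2 (not_bddBelow_iff.1 hb _)))

theorem numericalSpectrum_classification (hA : Dense (A.domain : Set X)) :
    numericalSpectrum A = univ ∨
      (∃ θ ∈ Ico (0 : ℝ) (2 * Real.pi), ∃ ω : ℝ, numericalSpectrum A = (halfPlane θ ω)ᶜ) ∨
      (∃ θ ∈ Ico (0 : ℝ) (2 * Real.pi), ∃ δ ∈ Ioo (0 : ℝ) (Real.pi / 2), ∃ z : ℂ,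
        numericalSpectrum A ⊆ sector θ δ z) ∨
      (∃ θ ∈ Ico (0 : ℝ) (2 * Real.pi), ∃ ω₁ ω₂ : ℝ, ω₁ < ω₂ ∧
        numericalSpectrum A ⊆ strip θ ω₁ ω₂) ∨
      IsCompact (numericalSpectrum A) := by
  by_cases hne : ∃ θ ω, IsMDissipative (rot θ A) ω
  swap
  · exact .inl ((numericalSpectrum_eq_univ_iff hA).2 hne)
  rw [← exists_mem_Ico_iff fun θ => by simp only [rot_toIcoMod]] at hne
  obtain ⟨θ₀, hθ₀, ω₀, h₀⟩ := hne
  by_cases huniq : ∀ φ ∈ Ico (0 : ℝ) (2 * Real.pi), ∀ ω, IsMDissipative (rot φ A) ω → φ = θ₀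
  · rcases eq_compl_halfPlane_or_eq_empty_of_forall_eq hA h₀ huniq with ⟨ω, h⟩ | h
    · exact .inr (.inl ⟨θ₀, hθ₀, ω, h⟩)
    · exact .inr (.inr (.inr (.inr (h ▸ isCompact_empty))))
  · push Not at huniq
    obtain ⟨θ₁, hθ₁, ω₁, h₁, hneq⟩ := huniq
    have htwo : (∃ θ, ∃ δ ∈ Ioo (0 : ℝ) (Real.pi / 2), ∃ z : ℂ,
          numericalSpectrum A ⊆ sector θ δ z) ∨
        ∃ θ, ∃ ω₁ ω₂ : ℝ, ω₁ < ω₂ ∧ numericalSpectrum A ⊆ strip θ ω₁ ω₂ := by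
      rcases hneq.lt_or_gt with hlt | hlt
      · exact exists_subset_sector_or_exists_subset_strip hA hlt
          (by linarith [hθ₀.2, hθ₁.1]) h₁ h₀
      · exact exists_subset_sector_or_exists_subset_strip hA hlt
          (by linarith [hθ₁.2, hθ₀.1]) h₀ h₁
    rcases htwo with h | h
    · exact .inr (.inr (.inl
        ((exists_mem_Ico_iff fun θ => by simp only [sector_toIcoMod]).2 h)))
    · exact .inr (.inr (.inr (.inl
        ((exists_mem_Ico_iff fun θ => by simp only [strip_toIcoMod]).2 h))))

end Classification

section GenerationCorrespondence

variable {X : Type*} [NormedAddCommGroup X] [NormedSpace ℂ X] [CompleteSpace X]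
variable {A : X →ₗ.[ℂ] X}

theorem subset_compl_halfPlane_iff_generates (hA : Dense (A.domain : Set X)) (θ ω : ℝ) :
    numericalSpectrum A ⊆ (halfPlane θ ω)ᶜ ↔ GeneratesContractive (rot θ A) ω :=
  (numericalSpectrum_subset_compl_halfPlane_iff hA).trans
    (generatesContractive_iff_isMDissipative (A := rot θ A) hA).symm

theorem subset_strip_iff_generates (hA : Dense (A.domain : Set X)) (θ ω₁ ω₂ : ℝ) :
    numericalSpectrum A ⊆ strip θ ω₁ ω₂ ↔
      GeneratesContractive (rot (-θ) A) ω₂ ∧ GeneratesContractive (-(rot (-θ) A)) (-ω₁) := by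
  rw [strip_eq_inter, subset_inter_iff, subset_compl_halfPlane_iff_generates hA,
    subset_compl_halfPlane_iff_generates hA, rot_pi_add]

theorem exists_subset_sector_iff_generates (hA : Dense (A.domain : Set X)) (θ : ℝ) :
    (∃ δ ∈ Ioo (0 : ℝ) (Real.pi / 2), ∃ z : ℂ, numericalSpectrum A ⊆ sector θ δ z) ↔
      ∃ ω : ℝ, GeneratesAnalyticContractive (rot (Real.pi - θ) A) ω := by
  constructor
  · rintro ⟨δ, ⟨hδ₀, hδ₁⟩, z, h⟩
    have hα : Real.pi / 2 - δ ∈ Ioo 0 (Real.pi / 2) := ⟨by linarith, by linarith⟩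
    rw [← sub_sub_cancel (Real.pi / 2) δ, numericalSpectrum_subset_sector_iff hA hα] at h
    have hconj : conj (exp (-(I * (-(Real.pi / 2 - δ) : ℝ)))) =
        exp (-(I * (Real.pi / 2 - δ : ℝ))) := by
      rw [← Complex.exp_conj]
      simp only [map_neg, map_mul, Complex.conj_I, Complex.conj_ofReal, Complex.ofReal_neg,
        neg_mul_neg]
    refine exists_generatesAnalyticContractive (A := rot (Real.pi - θ) A) hA
      (c := exp (-(I * (-(Real.pi / 2 - δ) : ℝ)))) ?_ ?_ h.2 (hconj ▸ h.1)
    · rw [exp_neg_I_mul_re, Real.cos_neg, Real.cos_pi_div_two_sub]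
      exact Real.sin_pos_of_pos_of_lt_pi hδ₀ (by linarith)
    · rw [exp_neg_I_mul_im, Real.sin_neg, neg_neg, Real.sin_pi_div_two_sub]
      exact Real.cos_pos_of_mem_Ioo ⟨by linarith, hδ₁⟩
  · rintro ⟨ω, h⟩
    obtain ⟨δ, hδ₀, hδ₁, h⟩ := h.exists_generatesContractive_smul
    obtain ⟨z, hz : _ * z = (ω : ℂ)⟩ :=
      mul_left_surjective₀ (Complex.exp_ne_zero (-(I * (Real.pi - θ : ℝ)))) (ω : ℂ)
    have hdiss : ∀ φ : ℝ, |φ| < δ → IsMDissipative (rot φ (rot (Real.pi - θ) A))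
        (exp (-(I * φ)) * (exp (-(I * (Real.pi - θ : ℝ))) * z)).re := fun φ hφ => by
      rw [hz, mul_comm, Complex.re_ofReal_mul]
      exact (generatesContractive_iff_isMDissipative (A := rot φ (rot (Real.pi - θ) A)) hA).1
        (h _ (exp_neg_I_mul_mem_openSector hφ hδ₁))
    have habs : |δ / 2| < δ := by rw [abs_of_pos (half_pos hδ₀)]; exact half_lt_self hδ₀
    exact ⟨Real.pi / 2 - δ / 2, ⟨by linarith, by linarith⟩, z,
      (numericalSpectrum_subset_sector_iff hA ⟨half_pos hδ₀, by linarith⟩).2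
        ⟨hdiss _ habs, hdiss _ (by rwa [abs_neg])⟩⟩

theorem generatesIsometricGroup_rot_iff (hA : Dense (A.domain : Set X)) (θ : ℝ) :
    GeneratesIsometricGroup (rot θ A) ↔
      numericalSpectrum A ⊆ {w | (exp (-(I * θ)) * w).re = 0} := by
  rw [setOf_re_exp_mul_eq_zero, subset_inter_iff, numericalSpectrum_subset_compl_halfPlane_iff hA,
    numericalSpectrum_subset_compl_halfPlane_iff hA, rot_pi_add]
  exact generatesIsometricGroup_iff_isMDissipative (A := rot θ A) hA

theorem generatesIsometricGroup_iff (hA : Dense (A.domain : Set X)) :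
    GeneratesIsometricGroup A ↔ numericalSpectrum A ⊆ {w | w.re = 0} := by
  simpa [rot_zero] using generatesIsometricGroup_rot_iff hA 0

theorem exists_subset_compl_halfPlane_iff (hA : Dense (A.domain : Set X)) :
    (∃ θ ∈ Ico (0 : ℝ) (2 * Real.pi), ∃ ω : ℝ, numericalSpectrum A ⊆ (halfPlane θ ω)ᶜ) ↔
      ∃ θ ∈ Ico (0 : ℝ) (2 * Real.pi), ∃ ω : ℝ, GeneratesContractive (rot θ A) ω := by
  simp only [subset_compl_halfPlane_iff_generates hA]

theorem numericalSpectrum_eq_univ_iff_not_exists_generates (hA : Dense (A.domain : Set X)) :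
    numericalSpectrum A = univ ↔
      ¬ ∃ θ ∈ Ico (0 : ℝ) (2 * Real.pi), ∃ ω : ℝ, GeneratesContractive (rot θ A) ω := by
  rw [exists_mem_Ico_iff fun θ => by simp only [rot_toIcoMod], numericalSpectrum_eq_univ_iff hA]
  simp only [← subset_compl_halfPlane_iff_generates hA,
    numericalSpectrum_subset_compl_halfPlane_iff hA]

theorem exists_subset_sector_iff_exists_generates (hA : Dense (A.domain : Set X)) :
    (∃ θ ∈ Ico (0 : ℝ) (2 * Real.pi), ∃ δ ∈ Ioo (0 : ℝ) (Real.pi / 2), ∃ z : ℂ,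
        numericalSpectrum A ⊆ sector θ δ z) ↔
      ∃ θ ∈ Ico (0 : ℝ) (2 * Real.pi), ∃ ω : ℝ, GeneratesAnalyticContractive (rot θ A) ω := by
  rw [exists_mem_Ico_iff fun θ => by simp only [sector_toIcoMod],
    exists_mem_Ico_iff fun θ => by simp only [rot_toIcoMod]]
  refine Iff.trans ?_ (Equiv.subLeft Real.pi).surjective.exists.symm
  exact exists_congr (exists_subset_sector_iff_generates hA)

theorem exists_subset_strip_iff_exists_generates (hA : Dense (A.domain : Set X)) :
    (∃ θ ∈ Ico (0 : ℝ) (2 * Real.pi), ∃ ω₁ ω₂ : ℝ, ω₁ < ω₂ ∧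
        numericalSpectrum A ⊆ strip θ ω₁ ω₂) ↔
      ∃ θ ∈ Ico (0 : ℝ) (2 * Real.pi), ∃ ω₁ ω₂ : ℝ, ω₁ < ω₂ ∧
        GeneratesContractive (rot θ A) ω₂ ∧ GeneratesContractive (-(rot θ A)) (-ω₁) := by
  rw [exists_mem_Ico_iff fun θ => by simp only [strip_toIcoMod],
    exists_mem_Ico_iff fun θ => by simp only [rot_toIcoMod]]
  refine Iff.trans ?_ neg_surjective.exists.symm
  simp only [subset_strip_iff_generates hA]

end GenerationCorrespondence

end NumericalSpectrum

open NumericalSpectrum in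
theorem proposition2p11_general {X : Type*} [NormedAddCommGroup X] [NormedSpace ℂ X]
    [CompleteSpace X] (A : X →ₗ.[ℂ] X) (hdense : Dense (A.domain : Set X)) :
    (numericalSpectrum A = Set.univ ∨
      (∃ θ ∈ Set.Ico (0 : ℝ) (2 * Real.pi), ∃ ω : ℝ, numericalSpectrum A = (halfPlane θ ω)ᶜ) ∨
      (∃ θ ∈ Set.Ico (0 : ℝ) (2 * Real.pi), ∃ δ ∈ Set.Ioo (0 : ℝ) (Real.pi / 2), ∃ z : ℂ,
        numericalSpectrum A ⊆ sector θ δ z) ∨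
      (∃ θ ∈ Set.Ico (0 : ℝ) (2 * Real.pi), ∃ ω₁ ω₂ : ℝ, ω₁ < ω₂ ∧
        numericalSpectrum A ⊆ strip θ ω₁ ω₂) ∨
      IsCompact (numericalSpectrum A)) ∧
    (numericalSpectrum A = Set.univ ↔
      ¬ ∃ θ ∈ Set.Ico (0 : ℝ) (2 * Real.pi), ∃ ω : ℝ, GeneratesContractive (rot θ A) ω) ∧
    ((∃ θ ∈ Set.Ico (0 : ℝ) (2 * Real.pi), ∃ ω : ℝ, numericalSpectrum A ⊆ (halfPlane θ ω)ᶜ) ↔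
      ∃ θ ∈ Set.Ico (0 : ℝ) (2 * Real.pi), ∃ ω : ℝ, GeneratesContractive (rot θ A) ω) ∧
    ((∃ θ ∈ Set.Ico (0 : ℝ) (2 * Real.pi), ∃ δ ∈ Set.Ioo (0 : ℝ) (Real.pi / 2), ∃ z : ℂ,
        numericalSpectrum A ⊆ sector θ δ z) ↔
      ∃ θ ∈ Set.Ico (0 : ℝ) (2 * Real.pi), ∃ ω : ℝ, GeneratesAnalyticContractive (rot θ A) ω) ∧
    ((∃ θ ∈ Set.Ico (0 : ℝ) (2 * Real.pi), ∃ ω₁ ω₂ : ℝ, ω₁ < ω₂ ∧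
        numericalSpectrum A ⊆ strip θ ω₁ ω₂) ↔
      ∃ θ ∈ Set.Ico (0 : ℝ) (2 * Real.pi), ∃ ω₁ ω₂ : ℝ, ω₁ < ω₂ ∧
        GeneratesContractive (rot θ A) ω₂ ∧ GeneratesContractive (-(rot θ A)) (-ω₁)) ∧
    (IsCompact (numericalSpectrum A) ↔ GeneratesNormContinuous A) ∧
    ((∃ K : Set ℂ, IsCompact K ∧ numericalSpectrum A ⊆ K) ↔ GeneratesNormContinuous A) ∧
    (∀ θ ω : ℝ, numericalSpectrum A ⊆ (halfPlane θ ω)ᶜ ↔ GeneratesContractive (rot θ A) ω) ∧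
    (∀ θ : ℝ, (∃ δ ∈ Set.Ioo (0 : ℝ) (Real.pi / 2), ∃ z : ℂ,
        numericalSpectrum A ⊆ sector θ δ z) ↔
      ∃ ω : ℝ, GeneratesAnalyticContractive (rot (Real.pi - θ) A) ω) ∧
    (∀ θ ω₁ ω₂ : ℝ, ω₁ < ω₂ → (numericalSpectrum A ⊆ strip θ ω₁ ω₂ ↔
      GeneratesContractive (rot (-θ) A) ω₂ ∧ GeneratesContractive (-(rot (-θ) A)) (-ω₁))) ∧
    (GeneratesIsometricGroup A ↔ numericalSpectrum A ⊆ {w | w.re = 0}) ∧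
    (∀ θ : ℝ, GeneratesIsometricGroup (rot θ A) ↔
      numericalSpectrum A ⊆ {w | (Complex.exp (-(Complex.I * θ)) * w).re = 0}) :=
  ⟨numericalSpectrum_classification hdense,
    numericalSpectrum_eq_univ_iff_not_exists_generates hdense,
    exists_subset_compl_halfPlane_iff hdense,
    exists_subset_sector_iff_exists_generates hdense,
    exists_subset_strip_iff_exists_generates hdense,
    (isCompact_numericalSpectrum_iff_exists_subset hdense).trans
      (exists_isCompact_iff_generatesNormContinuous hdense),
    exists_isCompact_iff_generatesNormContinuous hdense,
    subset_compl_halfPlane_iff_generates hdense,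
    exists_subset_sector_iff_generates hdense,
    fun θ ω₁ ω₂ _ => subset_strip_iff_generates hdense θ ω₁ ω₂,
    generatesIsometricGroup_iff hdense,
    generatesIsometricGroup_rot_iff hdense⟩

open NumericalSpectrum in
theorem proposition2p11 {X : Type*} [NormedAddCommGroup X] [NormedSpace ℂ X] [CompleteSpace X]
    (A : X →ₗ.[ℂ] X) (hclosed : A.IsClosed) (hdense : Dense (A.domain : Set X)) :
    -- at least one of the five classes
    (numericalSpectrum A = Set.univ ∨
      (∃ θ ∈ Set.Ico (0 : ℝ) (2 * Real.pi), ∃ ω : ℝ, numericalSpectrum A = (halfPlane θ ω)ᶜ) ∨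
      (∃ θ ∈ Set.Ico (0 : ℝ) (2 * Real.pi), ∃ δ ∈ Set.Ioo (0 : ℝ) (Real.pi / 2), ∃ z : ℂ,
        numericalSpectrum A ⊆ sector θ δ z) ∨
      (∃ θ ∈ Set.Ico (0 : ℝ) (2 * Real.pi), ∃ ω₁ ω₂ : ℝ, ω₁ < ω₂ ∧
        numericalSpectrum A ⊆ strip θ ω₁ ω₂) ∨
      IsCompact (numericalSpectrum A)) ∧
    -- (1) the whole plane
    (numericalSpectrum A = Set.univ ↔
      ¬ ∃ θ ∈ Set.Ico (0 : ℝ) (2 * Real.pi), ∃ ω : ℝ, GeneratesContractive (rot θ A) ω) ∧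
    -- (2) contained in a half plane
    ((∃ θ ∈ Set.Ico (0 : ℝ) (2 * Real.pi), ∃ ω : ℝ, numericalSpectrum A ⊆ (halfPlane θ ω)ᶜ) ↔
      ∃ θ ∈ Set.Ico (0 : ℝ) (2 * Real.pi), ∃ ω : ℝ, GeneratesContractive (rot θ A) ω) ∧
    -- (3) contained in a sector
    ((∃ θ ∈ Set.Ico (0 : ℝ) (2 * Real.pi), ∃ δ ∈ Set.Ioo (0 : ℝ) (Real.pi / 2), ∃ z : ℂ,
        numericalSpectrum A ⊆ sector θ δ z) ↔
      ∃ θ ∈ Set.Ico (0 : ℝ) (2 * Real.pi), ∃ ω : ℝ, GeneratesAnalyticContractive (rot θ A) ω) ∧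
    -- (4) contained in a strip
    ((∃ θ ∈ Set.Ico (0 : ℝ) (2 * Real.pi), ∃ ω₁ ω₂ : ℝ, ω₁ < ω₂ ∧
        numericalSpectrum A ⊆ strip θ ω₁ ω₂) ↔
      ∃ θ ∈ Set.Ico (0 : ℝ) (2 * Real.pi), ∃ ω₁ ω₂ : ℝ, ω₁ < ω₂ ∧
        GeneratesContractive (rot θ A) ω₂ ∧ GeneratesContractive (-(rot θ A)) (-ω₁)) ∧
    -- (5) compact
    (IsCompact (numericalSpectrum A) ↔ GeneratesNormContinuous A) ∧
    ((∃ K : Set ℂ, IsCompact K ∧ numericalSpectrum A ⊆ K) ↔ GeneratesNormContinuous A) ∧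
    -- the angles and bounds in (2), (3), (4) correspond to each other
    (∀ θ ω : ℝ, numericalSpectrum A ⊆ (halfPlane θ ω)ᶜ ↔ GeneratesContractive (rot θ A) ω) ∧
    (∀ θ : ℝ, (∃ δ ∈ Set.Ioo (0 : ℝ) (Real.pi / 2), ∃ z : ℂ,
        numericalSpectrum A ⊆ sector θ δ z) ↔
      ∃ ω : ℝ, GeneratesAnalyticContractive (rot (Real.pi - θ) A) ω) ∧
    (∀ θ ω₁ ω₂ : ℝ, ω₁ < ω₂ → (numericalSpectrum A ⊆ strip θ ω₁ ω₂ ↔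
      GeneratesContractive (rot (-θ) A) ω₂ ∧ GeneratesContractive (-(rot (-θ) A)) (-ω₁))) ∧
    -- isometric groups
    (GeneratesIsometricGroup A ↔ numericalSpectrum A ⊆ {w | w.re = 0}) ∧
    (∀ θ : ℝ, GeneratesIsometricGroup (rot θ A) ↔
      numericalSpectrum A ⊆ {w | (Complex.exp (-(Complex.I * θ)) * w).re = 0}) := by
  exact proposition2p11_general A hdense
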